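/- Let $M$ be a smooth finite-dimensional manifold (Hausdorff, second countable, without boundary), $F:TM\to[0,\infty)$ a Finsler metric (smooth on $TM\setminus 0$, vanishing exactly on the zero section, positively $1$-homogeneous, with positive definite fundamental tensor $g_w(u,v)=\frac12\frac{\partial^2}{\partial t\partial s}\big|_{(0,0)}F(w+su+tv)^2$ for $w\neq 0$), and $\mathcal P\subset M$ an embedded submanifold. Notation. $\pi:TM\setminus0\to M$ is the projection, $\mathscr VTM=\ker \mathrm d\pi$, $i_w:T_{\pi(w)}M\to\mathscr V_wTM$ is the vertical lift $i_w(u)=\frac{d}{dt}|_{t=0}(w+tu)$, $U^{\mathfrak v}(w)=i_w(U(\pi(w)))$ is the vertical lift of a vector field $U$ on $M$, $C(w)=i_w(w)$, $\mathscr J(X)=i_w(\mathrm d\pi(X))$ for $X\in T_w(TM\setminus0)$, and $g$ also denotes the metric on $\mathscr VTM$ induced by $g_w$ and $i_w$. Let $\omega_F=-\mathrm d\theta_F$, with $\theta_F(X)=g_w(w,\mathrm d\pi X)$ for $X\in T_w(TM\setminus 0)$, be the pull-back of the canonical symplectic form of $T^*M$ under the Legendre transformation $w\mapsto g_w(w,\cdot)$.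 Let $S$ be the geodesic spray, $\mathrm d(\tfrac12F^2)=\omega_F(S,\cdot)$, let $\Gamma_S=-[S,\mathscr J]$ be its canonical connection, $\mathscr HTM=\ker(\Gamma_S-\mathbf I)$, $\mathscr V=\frac12(\mathbf I-\Gamma_S)$ the vertical projection, and $u^{\mathfrak h}$ the horizontal lift of $u$. A linear connection $\nabla$ on the bundle $\mathscr VTM\to TM\setminus0$ is a lift of $\Gamma_S$ if $\nabla_XC=\mathscr VX$ for all $X$. Put $\mathrm T(X,Y)=\nabla_X\mathscr J(Y)-\nabla_Y\mathscr J(X)-\mathscr J[X,Y]$, $\mathscr C(X,Y)=\mathrm T(\mathscr J(X),Y)$, and consider the conditions (M1) $(\nabla_X g)(Y,C)=0$ for all $X$ and all vertical $Y$; (M2) $g(\mathscr C(X,Y),\mathscr J(S))=0$ for all $X,Y$. For $u\in T_{\pi(w)}M$ and a vector field $V$ near $\pi(w)$ put $D^w_uV=i_w^{-1}\nabla_{u^{\mathfrak h}}V^{\mathfrak v}$, where $u^{\mathfrak h}$ is taken at $w$. Let $\nu(\mathcal P)$ be the set of all $\eta\in T_xM\setminus0$, $x\in\mathcal P$, with $g_\eta(\eta,u)=0$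 for all $u\in T_x\mathcal P$. For $\eta\in\nu(\mathcal P)$ with $x=\pi(\eta)$, the second fundamental form built from $\nabla$ is $$\mathrm h^{\mathcal P}_\eta(u,v)=\tfrac12\,g_\eta\bigl(\eta,\;D^\eta_uV+D^\eta_vU\bigr),\qquad u,v\in T_x\mathcal P,$$ where $U,V$ are any vector fields, smooth near $x$ in $M$ and tangent to $\mathcal P$ along $\mathcal P$, with $U(x)=u$, $V(x)=v$. Statement. (1) $\nu(\mathcal P)$ is a Lagrangian submanifold of $(TM\setminus0,\omega_F)$. (2) For every $\eta\in\nu(\mathcal P)$, $x=\pi(\eta)$, there is exactly one symmetric bilinear form $\mathrm b_\eta$ on $T_x\mathcal P$ such that, under the identification $T_\eta TM\simeq T_xM\oplus T_xM$, $X\mapsto(\mathrm d\pi(X),i_\eta^{-1}\mathscr VX)$, $$T_\eta\nu(\mathcal P)=\{(u,v):u\in T_x\mathcal P\text{ and }g_\eta(v,\cdot)|_{T_x\mathcal P}+\mathrm b_\eta(u,\cdot)=0\}.$$ (3) For every lift $\nabla$ of $\Gamma_S$ satisfying (M1) and (M2), $\mathrm h^{\mathcal P}_\eta$ is well defined (independent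 of the extensions $U,V$) and $\mathrm h^{\mathcal P}_\eta=\mathrm b_\eta$. In particular $\mathrm h^{\mathcal P}_\eta$ does not depend on the choice of such a $\nabla$. -/

import Mathlib

open Set Bundle VectorField
open scoped Manifold ContDiff Topology

noncomputable section

namespace FinslerSFF

/-! ## Vector fields, one-forms and submanifolds of a manifold -/

section General

variable {E : Type*} [NormedAddCommGroup E] [NormedSpace ℝ E]
  {H : Type*} [TopologicalSpace H] (I : ModelWithCorners ℝ E H)
  {M : Type*} [TopologicalSpace M] [ChartedSpace H M]

/-- The vector field `X` is smooth on the set `O` (used for open sets `O`). -/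
def IsSmoothFieldOn [IsManifold I 1 M] (X : Π x : M, TangentSpace I x) (O : Set M) : Prop :=
  ContMDiffOn I I.tangent ∞ (fun x => (⟨x, X x⟩ : TangentBundle I M)) O

/-- A vector field, smooth near `x`, whose value at `x` is `v` (it has constant components in the
preferred chart at `x`). It is only used inside expressions that are tensorial in the field. -/
def localExtension [IsManifold I 1 M] {x : M} (v : TangentSpace I x) : Π y : M, TangentSpace I y :=
  FiberBundle.extend E (E := fun y : M => TangentSpace I y) v

/-- The exterior derivative of a one-form `θ`, through the invariant formula
`dθ(X, Y) = X (θ Y) - Y (θ X) - θ [X, Y]`. -/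
def extDerivOneForm [IsManifold I 1 M] (θ : Π x : M, TangentSpace I x → ℝ) (x : M)
    (X Y : TangentSpace I x) : ℝ :=
  mvfderiv I (fun y => θ y (localExtension I Y y)) x X
    - mvfderiv I (fun y => θ y (localExtension I X y)) x Y
    - θ x (mlieBracket I (localExtension I X) (localExtension I Y) x)

/-- `P` is an embedded (smooth) submanifold: near each of its points there is a slice chart, i.e. a
chart of the maximal smooth atlas in which `P` is an affine subspace.
The dimension may differ between components of `P`. -/
def IsEmbeddedSubmanifold (P : Set M) : Prop :=
  ∀ x ∈ P, ∃ φ ∈ IsManifold.maximalAtlas I ∞ M, x ∈ φ.source ∧ ∃ L : Submodule ℝ E,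
    ∀ y ∈ φ.source, (y ∈ P ↔ φ.extend I y - φ.extend I x ∈ L)

/-- The tangent space `T_x P` of a submanifold `P`, formed by the velocities at `x` of smooth curves
in `P` through `x`. (For a submanifold these velocities are a subspace, so the span adds
nothing.) -/
def tangentSpaceOf (P : Set M) (x : M) : Submodule ℝ (TangentSpace I x) :=
  Submodule.span ℝ {v | ∃ ε > (0 : ℝ), ∃ c : ℝ → M,
    ContMDiffOn 𝓘(ℝ, ℝ) I ∞ c (Ioo (-ε) ε) ∧ (∀ t ∈ Ioo (-ε) ε, c t ∈ P) ∧
    tangentMap 𝓘(ℝ, ℝ) I c ⟨0, (1 : ℝ)⟩ = (⟨x, v⟩ : TangentBundle I M)}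

/-- `N` is a Lagrangian submanifold for the two-form `Ω`: an embedded submanifold each of whose
tangent spaces is its own `Ω`-orthogonal. -/
def IsLagrangianSubmanifold (Ω : Π x : M, TangentSpace I x → TangentSpace I x → ℝ)
    (N : Set M) : Prop :=
  IsEmbeddedSubmanifold I N ∧ ∀ x ∈ N, ∀ X : TangentSpace I x,
    (X ∈ tangentSpaceOf I N x ↔ ∀ Y ∈ tangentSpaceOf I N x, Ω x X Y = 0)

end General

/-! ## The slit tangent bundle -/

variable {E : Type*} [NormedAddCommGroup E] [NormedSpace ℝ E]
  {M : Type*} [TopologicalSpace M] [ChartedSpace E M]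

/-- The tangent bundle `TM`. -/
abbrev TM (E M : Type*) [NormedAddCommGroup E] [NormedSpace ℝ E] [TopologicalSpace M]
    [ChartedSpace E M] : Type _ :=
  TangentBundle 𝓘(ℝ, E) M

/-- The slit tangent bundle `TM ∖ 0`, an open subset of `TM`. -/
def slit (E M : Type*) [NormedAddCommGroup E] [NormedSpace ℝ E] [TopologicalSpace M]
    [ChartedSpace E M] : Set (TM E M) :=
  {w | w.2 ≠ 0}

variable [IsManifold 𝓘(ℝ, E) ∞ M]

/-- The tangent space `T_w TM`. -/
abbrev TTM (w : TM E M) : Type _ := TangentSpace 𝓘(ℝ, E).tangent w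

/-- The differential `dπ(w) : T_w TM → T_{π(w)} M` of the projection. -/
def dpi (w : TM E M) : TTM w →L[ℝ] TangentSpace 𝓘(ℝ, E) w.proj :=
  mfderiv 𝓘(ℝ, E).tangent 𝓘(ℝ, E) (fun z : TM E M => z.proj) w

/-- The vertical lift `i_w(u) = (d/dt)|_{t=0} (w + t u)`. -/
def vlift (w : TM E M) (u : TangentSpace 𝓘(ℝ, E) w.proj) : TTM w :=
  mfderiv 𝓘(ℝ, ℝ) 𝓘(ℝ, E).tangent (fun t : ℝ => (⟨w.proj, w.2 + t • u⟩ : TM E M)) 0 (1 : ℝ)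

/-- The inverse `i_w⁻¹`, meaningful on vertical vectors. -/
def vliftInv (w : TM E M) : TTM w → TangentSpace 𝓘(ℝ, E) w.proj :=
  Function.invFun (vlift w)

/-- The vertical lift `V^𝔳` of a vector field `V` on `M`. -/
def vliftField (V : Π x : M, TangentSpace 𝓘(ℝ, E) x) (w : TM E M) : TTM w :=
  vlift w (V w.proj)

/-- The canonical vertical vector field `C`. -/
def canonicalField (w : TM E M) : TTM w := vlift w w.2

/-- The almost-tangent structure `J`. -/
def almostTangent (w : TM E M) (X : TTM w) : TTM w := vlift w (dpi w X)

/-- The Grifone connection `Γ_S = -[S, J]` (minus the Lie derivative of `J` along `S`), that is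
`Γ_S(X) = -([S, J X] - J [S, X])`. -/
def grifoneConnection (S : Π w : TM E M, TTM w) (w : TM E M) (X : TTM w) : TTM w :=
  -(mlieBracket 𝓘(ℝ, E).tangent S
        (fun z => almostTangent z (localExtension 𝓘(ℝ, E).tangent X z)) w
    - almostTangent w
        (mlieBracket 𝓘(ℝ, E).tangent S (localExtension 𝓘(ℝ, E).tangent X) w))

/-- The vertical projection `𝒱` along the horizontal distribution `ker (Γ_S - 1)`. -/
def verticalProj (S : Π w : TM E M, TTM w) (w : TM E M) (X : TTM w) : TTM w :=
  (1 / 2 : ℝ) • (X - grifoneConnection S w X)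

/-- The horizontal lift `u^𝔥` of `u` at `w`: the vector `X ∈ ker (Γ_S - 1)` with `dπ(X) = u`. -/
def hlift (S : Π w : TM E M, TTM w) (w : TM E M) (u : TangentSpace 𝓘(ℝ, E) w.proj) : TTM w :=
  Classical.epsilon fun X : TTM w => grifoneConnection S w X = X ∧ dpi w X = u

/-! ## Linear connections on the vertical bundle -/

/-- `Y` is a smooth section over `O` of the vertical tangent bundle. -/
def IsVerticalSectionOn (Y : Π w : TM E M, TTM w) (O : Set (TM E M)) : Prop :=
  IsSmoothFieldOn 𝓘(ℝ, E).tangent Y O ∧ ∀ w ∈ O, dpi w (Y w) = 0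

variable (E M) in
/-- A linear connection `∇` on the vertical tangent bundle over `TM ∖ 0`, acting on local
sections: `D w X Y` is `∇_X Y` for `X ∈ T_w TM` and a vertical section `Y` defined near `w`. -/
structure VerticalConnection where
  /-- The covariant derivative `∇_X Y ∈ T_w TM`. -/
  D : Π w : TM E M, TTM w → (Π z : TM E M, TTM z) → TTM w
  /-- `∇_X Y` depends only on the restriction of `Y` to a neighbourhood. -/
  congr' : ∀ (O : Set (TM E M)), IsOpen O → O ⊆ slit E M → ∀ w ∈ O, ∀ X Y Y',
    IsVerticalSectionOn Y O → (∀ z ∈ O, Y z = Y' z) → D w X Y = D w X Y'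
  vertical : ∀ (O : Set (TM E M)), IsOpen O → O ⊆ slit E M → ∀ w ∈ O, ∀ X Y,
    IsVerticalSectionOn Y O → dpi w (D w X Y) = 0
  map_add_left : ∀ (O : Set (TM E M)), IsOpen O → O ⊆ slit E M → ∀ w ∈ O, ∀ X X' Y,
    IsVerticalSectionOn Y O → D w (X + X') Y = D w X Y + D w X' Y
  map_smul_left : ∀ (O : Set (TM E M)), IsOpen O → O ⊆ slit E M → ∀ w ∈ O, ∀ (a : ℝ) X Y,
    IsVerticalSectionOn Y O → D w (a • X) Y = a • D w X Y
  map_add : ∀ (O : Set (TM E M)), IsOpen O → O ⊆ slit E M → ∀ w ∈ O, ∀ X Y Y',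
    IsVerticalSectionOn Y O → IsVerticalSectionOn Y' O →
    D w X (fun z => Y z + Y' z) = D w X Y + D w X Y'
  leibniz : ∀ (O : Set (TM E M)), IsOpen O → O ⊆ slit E M → ∀ w ∈ O, ∀ X Y (f : TM E M → ℝ),
    IsVerticalSectionOn Y O → ContMDiffOn 𝓘(ℝ, E).tangent 𝓘(ℝ, ℝ) ∞ f O →
    D w X (fun z => f z • Y z) = mvfderiv 𝓘(ℝ, E).tangent f w X • Y w + f w • D w X Y
  smooth : ∀ (O : Set (TM E M)), IsOpen O → O ⊆ slit E M →
    ∀ X Y : Π z : TM E M, TTM z, IsSmoothFieldOn 𝓘(ℝ, E).tangent X O → IsVerticalSectionOn Y O →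
    IsSmoothFieldOn 𝓘(ℝ, E).tangent (fun w => D w (X w) Y) O

namespace VerticalConnection

variable (N : VerticalConnection E M)

/-- `∇` is a lift of `Γ_S`: `∇_X C = 𝒱 X` for all `X ∈ T(TM ∖ 0)`. -/
def IsLift (S : Π w : TM E M, TTM w) : Prop :=
  ∀ w ∈ slit E M, ∀ X : TTM w, N.D w X canonicalField = verticalProj S w X

/-- The torsion `T(X, Y) = ∇_X J(Y) - ∇_Y J(X) - J[X, Y]`. -/
def torsion (X Y : Π w : TM E M, TTM w) (w : TM E M) : TTM w :=
  N.D w (X w) (fun z => almostTangent z (Y z)) - N.D w (Y w) (fun z => almostTangent z (X z))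
    - almostTangent w (mlieBracket 𝓘(ℝ, E).tangent X Y w)

/-- The tensor `𝒞(X, Y) = T(J(X), Y)`. -/
def vertTorsion (X Y : Π w : TM E M, TTM w) (w : TM E M) : TTM w :=
  N.torsion (fun z => almostTangent z (X z)) Y w

/-- The covariant derivative `D^w_u V = i_w⁻¹ ∇_{u^𝔥} V^𝔳` of the family of affine connections
associated with `∇`. -/
def affine (S : Π w : TM E M, TTM w) (w : TM E M) (u : TangentSpace 𝓘(ℝ, E) w.proj)
    (V : Π x : M, TangentSpace 𝓘(ℝ, E) x) : TangentSpace 𝓘(ℝ, E) w.proj :=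
  vliftInv w (N.D w (hlift S w u) (vliftField V))

end VerticalConnection

/-! ## Finsler metrics -/

/-- `g_w(u, v) = (1/2) ∂²/∂t∂s|_{(0,0)} F(w + s u + t v)²`. -/
def fiberHessian (F : TM E M → ℝ) (w : TM E M) (u v : TangentSpace 𝓘(ℝ, E) w.proj) : ℝ :=
  (1 / 2) * deriv (fun t : ℝ => deriv (fun s : ℝ =>
    F (⟨w.proj, w.2 + s • u + t • v⟩ : TM E M) ^ 2) 0) 0

variable (E M) in
/-- A Finsler metric on `M`. -/
structure FinslerMetric where
  F : TM E M → ℝ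
  nonneg : ∀ w, 0 ≤ F w
  smooth : ContMDiffOn 𝓘(ℝ, E).tangent 𝓘(ℝ, ℝ) ∞ F (slit E M)
  eq_zero_iff : ∀ w : TM E M, F w = 0 ↔ w.2 = 0
  homogeneous : ∀ (x : M) (u : TangentSpace 𝓘(ℝ, E) x) (a : ℝ), 0 < a →
    F ⟨x, a • u⟩ = a * F ⟨x, u⟩
  posDef : ∀ w ∈ slit E M, ∀ u : TangentSpace 𝓘(ℝ, E) w.proj, u ≠ 0 → 0 < fiberHessian F w u u

namespace FinslerMetric

variable (F : FinslerMetric E M)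

/-- The fundamental tensor `g_w` on `T_{π(w)} M`. -/
def g (w : TM E M) (u v : TangentSpace 𝓘(ℝ, E) w.proj) : ℝ := fiberHessian F.F w u v

/-- The induced metric `g` on the vertical tangent bundle. -/
def gV (w : TM E M) (X Y : TTM w) : ℝ := F.g w (vliftInv w X) (vliftInv w Y)

/-- The pull-back `𝓛^*θ` of the canonical one-form `θ_ξ(Z) = ξ(dπ Z)` of `T^*M` under the Legendre
transformation `𝓛(w) = g_w(w, ·)`. -/
def hilbertForm (w : TM E M) (X : TTM w) : ℝ := F.g w w.2 (dpi w X)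

/-- The symplectic form `ω_F = 𝓛^*(-dθ) = -d(𝓛^*θ)` on `TM ∖ 0`. -/
def omega (w : TM E M) (X Y : TTM w) : ℝ :=
  -extDerivOneForm 𝓘(ℝ, E).tangent (F.hilbertForm) w X Y

/-- The energy function `F² / 2`. -/
def energy (w : TM E M) : ℝ := (1 / 2) * F.F w ^ 2

/-- The geodesic spray `S` of `F`: the vector field on `TM ∖ 0` with `dE = ω_F(S, ·)`. -/
def spray (w : TM E M) : TTM w :=
  Classical.epsilon fun X : TTM w =>
    ∀ Y : TTM w, mvfderiv 𝓘(ℝ, E).tangent F.energy w Y = F.omega w X Y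

/-- The normal bundle `ν(P) ⊆ TM ∖ 0`. -/
def normalBundle (P : Set M) : Set (TM E M) :=
  {η | η.proj ∈ P ∧ η ∈ slit E M ∧ ∀ u ∈ tangentSpaceOf 𝓘(ℝ, E) P η.proj, F.g η η.2 u = 0}

/-- Condition (M1): `(∇_X g)(Y, C) = 0` for all `X` and all vertical `Y`. -/
def M1 (N : VerticalConnection E M) : Prop :=
  ∀ O : Set (TM E M), IsOpen O → O ⊆ slit E M → ∀ Y, IsVerticalSectionOn Y O →
    ∀ w ∈ O, ∀ X : TTM w,
      mvfderiv 𝓘(ℝ, E).tangent (fun z => F.gV z (Y z) (canonicalField z)) w X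
        - F.gV w (N.D w X Y) (canonicalField w)
        - F.gV w (Y w) (N.D w X canonicalField) = 0

/-- Condition (M2): `𝒞_♭(X, Y, S) = g(𝒞(X, Y), J(S)) = 0` for all `X`, `Y`. -/
def M2 (N : VerticalConnection E M) : Prop :=
  ∀ O : Set (TM E M), IsOpen O → O ⊆ slit E M → ∀ X Y,
    IsSmoothFieldOn 𝓘(ℝ, E).tangent X O → IsSmoothFieldOn 𝓘(ℝ, E).tangent Y O →
    ∀ w ∈ O, F.gV w (N.vertTorsion X Y w) (almostTangent w (F.spray w)) = 0

/-- `h` is the second fundamental form of `P` in the normal direction `η`, constructed with `∇`: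
`h(u, v) = (1/2) g_η(η, D^η_U V + D^η_V U)` whatever the vector fields `U`, `V`, smooth near
`π(η)` and tangent to `P` along `P`, that extend `u` and `v`. -/
def IsSecondFundamentalForm (N : VerticalConnection E M) (P : Set M) (η : TM E M)
    (h : tangentSpaceOf 𝓘(ℝ, E) P η.proj → tangentSpaceOf 𝓘(ℝ, E) P η.proj → ℝ) : Prop :=
  ∀ u v : tangentSpaceOf 𝓘(ℝ, E) P η.proj, ∀ O : Set M, IsOpen O → η.proj ∈ O →
    ∀ U V : Π x : M, TangentSpace 𝓘(ℝ, E) x,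
      IsSmoothFieldOn 𝓘(ℝ, E) U O → IsSmoothFieldOn 𝓘(ℝ, E) V O →
      (∀ y ∈ O ∩ P, U y ∈ tangentSpaceOf 𝓘(ℝ, E) P y) →
      (∀ y ∈ O ∩ P, V y ∈ tangentSpaceOf 𝓘(ℝ, E) P y) →
      U η.proj = u → V η.proj = v →
      h u v = (1 / 2) * F.g η η.2
        (N.affine F.spray η (U η.proj) V + N.affine F.spray η (V η.proj) U)

/-- The tangent space `T_η ν(P)` is the one given by the form `b` on `T_x P`, `x = π(η)`: in terms
of the decomposition `X ↦ (dπ(X), i_η⁻¹ 𝒱 X)` of `T_η TM`,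
`T_η ν(P) = {(u, v) : u ∈ T_x P and g_η(v, ·)|_{T_x P} + b(u, ·) = 0}`. -/
def IsTangentForm (P : Set M) (η : TM E M)
    (b : LinearMap.BilinForm ℝ (tangentSpaceOf 𝓘(ℝ, E) P η.proj)) : Prop :=
  ∀ X : TTM η, X ∈ tangentSpaceOf 𝓘(ℝ, E).tangent (F.normalBundle P) η ↔
    ∃ hX : dpi η X ∈ tangentSpaceOf 𝓘(ℝ, E) P η.proj,
      ∀ u : tangentSpaceOf 𝓘(ℝ, E) P η.proj,
        F.g η (vliftInv η (verticalProj F.spray η X)) u + b ⟨dpi η X, hX⟩ u = 0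

end FinslerMetric

end FinslerSFF

end

/-! In a tangent chart with coordinates (x, y) write e = F²/2. By Euler's relation for the
2-homogeneous e, the covector g_w(w, ·) is the vertical derivative ∂_y e, so ν(P) is the preimage of
the conormal bundle of P under the Legendre map. This map is a local diffeomorphism because the
vertical Hessian of e is g_w, which is positive definite. If ψ flattens P to a subspace L, then (x,
y) ↦ (ψ(x), λ) with λ = ∂_y e ∘ (Dψ)⁻¹ flattens ν(P) to a translate of L × L°, where L° is the
annihilator of L (`exists_slice_normalBundle`). So ν(P) is an embedded submanifold.

Differentiating this map, (a, b) is tangent to ν(P) at η iff a ∈ T_xP and D²e(a, b)(0, u) − λ(D²ψ(a,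
u)) = 0 for all u ∈ T_xP. Let N be the canonical nonlinear connection and split (a, b) = (0, b + Na)
+ (a, −Na) into its vertical and horizontal parts. The equation becomes g(b + Na, u) + B(a, u) = 0
with B(a, u) = D²e(a, −Na)(0, u) − λ(D²ψ(a, u)) (`tangentBilin`), and B restricted to T_xP is the
required form. It is symmetric because D²ψ is and because horizontal spaces are isotropic for ω_F.
The latter is `nonlinConn_antisymm`, obtained by differentiating the geodesic equation vertically.
Symmetry of B together with nondegeneracy of g yields the Lagrangian property (`lagrangian_iff`).
The form is unique because every u ∈ T_xP is the projection of a vector tangent to ν(P).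

For the second fundamental form, a lift satisfies ∇C = 0 in horizontal directions, so (M1) turns
g_η(η, D_uV) into the derivative of g(V^𝔳, C) = ∂_y e(V) along u^𝔥 (`g_self_affine`). The product
rule gives D²e(u, −Nu)(0, V) + ∂_y e(DV·u). Tangency of V to P says Dψ·V ∈ L along P;
differentiating this along u and applying λ, which kills L, gives ∂_y e(DV·u) = −λ(D²ψ(u, V))
(`legendreRep_tangent_field`). Hence g_η(η, D_uV) = B(u, V), whatever the extension and the
connection. -/

noncomputable section

namespace FinslerSFF

set_option synthInstance.maxHeartbeats 200000

/-! ### Derivatives and brackets read in a chart -/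

section Charts

variable {E : Type*} [NormedAddCommGroup E] [NormedSpace ℝ E]
  {H : Type*} [TopologicalSpace H] (I : ModelWithCorners ℝ E H)
  {M : Type*} [TopologicalSpace M] [ChartedSpace H M]

/-- The differential at `x` of the preferred chart at `x₀`. -/
def chartDeriv (x₀ x : M) : TangentSpace I x →L[ℝ] E := mvfderiv I (extChartAt I x₀) x

/-- The vector field `V` read in the preferred chart at `x₀`. -/
def fieldRep (x₀ : M) (V : Π x : M, TangentSpace I x) (p : E) : E :=
  chartDeriv I x₀ ((extChartAt I x₀).symm p) (V ((extChartAt I x₀).symm p))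

variable {I} [IsManifold I ∞ M]

theorem chartDeriv_isInvertible {x₀ x : M} (hx : x ∈ (extChartAt I x₀).source) :
    (chartDeriv I x₀ x).IsInvertible := by
  have h : (mfderiv I 𝓘(ℝ, E) (extChartAt I x₀) x).IsInvertible :=
    isInvertible_mfderiv_extChartAt hx
  obtain ⟨e, he⟩ := h
  refine ⟨e.trans (NormedSpace.fromTangentSpace (extChartAt I x₀ x)), ?_⟩
  ext v
  have := congrArg (fun f => f v) he
  simp only [chartDeriv, mvfderiv]
  rw [← he]
  rfl

theorem chartDeriv_injective {x₀ x : M} (hx : x ∈ (extChartAt I x₀).source) :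
    Function.Injective (chartDeriv I x₀ x) := by
  obtain ⟨e, he⟩ := chartDeriv_isInvertible hx
  rw [← he]; exact e.injective

theorem chartDeriv_surjective {x₀ x : M} (hx : x ∈ (extChartAt I x₀).source) :
    Function.Surjective (chartDeriv I x₀ x) := by
  obtain ⟨e, he⟩ := chartDeriv_isInvertible hx
  rw [← he]; exact e.surjective

omit [IsManifold I ∞ M] in
theorem eventually_mem_extChartAt_source {x₀ x : M} (hx : x ∈ (extChartAt I x₀).source) :
    ∀ᶠ y in 𝓝 x, y ∈ (extChartAt I x₀).source :=
  (isOpen_extChartAt_source x₀).mem_nhds hx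

variable {F : Type*} [NormedAddCommGroup F] [NormedSpace ℝ F]

theorem mdifferentiableAt_of_rep {x₀ x : M} (hx : x ∈ (extChartAt I x₀).source) {f : M → F}
    (hf : DifferentiableAt ℝ (f ∘ (extChartAt I x₀).symm) (extChartAt I x₀ x)) :
    MDifferentiableAt I 𝓘(ℝ, F) f x := by
  have h1 : MDifferentiableAt I 𝓘(ℝ, E) (extChartAt I x₀) x :=
    mdifferentiableAt_extChartAt (by simpa using hx)
  have h2 := hf.mdifferentiableAt.comp x h1
  refine h2.congr_of_eventuallyEq ?_
  filter_upwards [eventually_mem_extChartAt_source hx] with y hy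
  exact (congrArg f ((extChartAt I x₀).left_inv hy)).symm

theorem mvfderiv_eq_fderiv_rep {x₀ x : M} (hx : x ∈ (extChartAt I x₀).source) {f : M → F}
    (hf : DifferentiableAt ℝ (f ∘ (extChartAt I x₀).symm) (extChartAt I x₀ x))
    (X : TangentSpace I x) :
    mvfderiv I f x X =
      fderiv ℝ (f ∘ (extChartAt I x₀).symm) (extChartAt I x₀ x) (chartDeriv I x₀ x X) := by
  have h1 : MDifferentiableAt I 𝓘(ℝ, E) (extChartAt I x₀) x :=
    mdifferentiableAt_extChartAt (by simpa using hx)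
  have h3 : f =ᶠ[𝓝 x] (f ∘ (extChartAt I x₀).symm) ∘ extChartAt I x₀ := by
    filter_upwards [eventually_mem_extChartAt_source hx] with y hy
    exact (congrArg f ((extChartAt I x₀).left_inv hy)).symm
  have h4 : mfderiv I 𝓘(ℝ, F) f x =
      mfderiv I 𝓘(ℝ, F) ((f ∘ (extChartAt I x₀).symm) ∘ extChartAt I x₀) x := h3.mfderiv_eq
  have h5 := mfderiv_comp x hf.mdifferentiableAt h1
  rw [mfderiv_eq_fderiv] at h5
  have h6 := congrArg (fun L => L X) (h4.trans h5)
  exact h6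

theorem contDiffAt_chart_change [I.Boundaryless] {x₀ x₁ x : M}
    (h0 : x ∈ (extChartAt I x₀).source)
    (h1 : x ∈ (extChartAt I x₁).source) :
    ContDiffAt ℝ ∞ (extChartAt I x₀ ∘ (extChartAt I x₁).symm) (extChartAt I x₁ x) := by
  have h := contDiffWithinAt_ext_coord_change (n := ∞) (I := I) x₀ x₁
    (y := extChartAt I x₁ x) (by
      simp only [PartialEquiv.trans_source, PartialEquiv.symm_source, mem_inter_iff, mem_preimage]
      exact ⟨(extChartAt I x₁).map_source h1, by rwa [(extChartAt I x₁).left_inv h1]⟩)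
  rwa [I.range_eq_univ, contDiffWithinAt_univ] at h

theorem chartDeriv_change [I.Boundaryless] {x₀ x₁ x : M} (h0 : x ∈ (extChartAt I x₀).source)
    (h1 : x ∈ (extChartAt I x₁).source) (X : TangentSpace I x) :
    chartDeriv I x₀ x X =
      fderiv ℝ (extChartAt I x₀ ∘ (extChartAt I x₁).symm) (extChartAt I x₁ x)
        (chartDeriv I x₁ x X) :=
  mvfderiv_eq_fderiv_rep h1
    ((contDiffAt_chart_change h0 h1).differentiableAt (by simp)) X

theorem trivializationAt_snd_eq_chartDeriv {x₀ x : M} (hx : x ∈ (extChartAt I x₀).source)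
    (v : TangentSpace I x) :
    (trivializationAt E (TangentSpace I) x₀ ⟨x, v⟩).2 = chartDeriv I x₀ x v := by
  have h := TangentBundle.continuousLinearMapAt_trivializationAt (I := I) (x₀ := x₀) (x := x)
    (by simpa using hx)
  have h2 := congrArg (fun L => L v) h
  have hb : x ∈ (trivializationAt E (TangentSpace I) x₀).baseSet := by simpa using hx
  have h3 : (trivializationAt E (TangentSpace I) x₀).continuousLinearMapAt ℝ x v =
      (trivializationAt E (TangentSpace I) x₀ ⟨x, v⟩).2 := by
    rw [Trivialization.continuousLinearMapAt_apply, Trivialization.linearMapAt_apply, if_pos hb]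
  rw [← h3]
  exact h2

theorem chartDeriv_localExtension {x₀ x : M} (hx : x ∈ (extChartAt I x₀).source)
    (v : TangentSpace I x₀) :
    chartDeriv I x₀ x (localExtension I v x) = chartDeriv I x₀ x₀ v := by
  have hb : x ∈ (trivializationAt E (TangentSpace I) x₀).baseSet := by simpa using hx
  rw [← trivializationAt_snd_eq_chartDeriv hx, localExtension, FiberBundle.extend,
    ← trivializationAt_snd_eq_chartDeriv (mem_extChartAt_source x₀)]
  have h := congrArg Prod.snd (Trivialization.apply_mk_symm
    (trivializationAt E (TangentSpace I) x₀) hb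
    (trivializationAt E (TangentSpace I) x₀ ⟨x₀, v⟩).2)
  exact h

omit [IsManifold I ∞ M] in
theorem extChartAt_symm_mem_of_eventually [I.Boundaryless] {x₀ x : M}
    (hx : x ∈ (extChartAt I x₀).source)
    {p : M → Prop} (hp : ∀ᶠ y in 𝓝 x, p y) :
    ∀ᶠ q in 𝓝 (extChartAt I x₀ x), p ((extChartAt I x₀).symm q) := by
  have hc : ContinuousAt (extChartAt I x₀).symm (extChartAt I x₀ x) :=
    continuousAt_extChartAt_symm' hx
  rw [ContinuousAt, (extChartAt I x₀).left_inv hx] at hc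
  exact hc.eventually hp

/-- The manifold bracket at x₀ is by definition the bracket of the pullbacks by the inverse of the
chart at x₀, and near the base point these pullbacks are the coordinate representations of the
fields. -/
theorem chartDeriv_mlieBracket [I.Boundaryless] {x₀ : M} (V W : Π x : M, TangentSpace I x) :
    chartDeriv I x₀ x₀ (mlieBracket I V W x₀) =
      lieBracket ℝ (fieldRep I x₀ V) (fieldRep I x₀ W) (extChartAt I x₀ x₀) := by
  have key : ∀ V : Π x : M, TangentSpace I x,
      (mpullbackWithin 𝓘(ℝ, E) I (extChartAt I x₀).symm V (range I) : E → E)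
        =ᶠ[𝓝 (extChartAt I x₀ x₀)] fieldRep I x₀ V := by
    intro V
    filter_upwards [extChartAt_target_mem_nhds (I := I) x₀] with p hp
    have h1 := mfderiv_extChartAt_comp_mfderivWithin_extChartAt_symm (I := I) hp
    have h2 := mfderivWithin_extChartAt_symm_comp_mfderiv_extChartAt (I := I) hp
    rw [mpullbackWithin_apply]
    have h3 := ContinuousLinearMap.inverse_eq h2 h1
    rw [h3]
    rfl
  have h := mlieBracketWithin_apply (I := I) (V := V) (W := W) (s := univ) (x₀ := x₀)
  rw [mlieBracketWithin_univ] at h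
  rw [h]
  have hinv : (mfderiv I 𝓘(ℝ, E) (extChartAt I x₀) x₀).IsInvertible :=
    isInvertible_mfderiv_extChartAt (mem_extChartAt_source x₀)
  have h4 : ∀ u : E, chartDeriv I x₀ x₀ ((mfderiv I 𝓘(ℝ, E) (extChartAt I x₀) x₀).inverse u) = u :=
    fun u => hinv.self_apply_inverse u
  refine (h4 _).trans ?_
  have h5 : ∀ (v w : E → E) (t : Set E), t = univ →
      v =ᶠ[𝓝 (extChartAt I x₀ x₀)] fieldRep I x₀ V →
      w =ᶠ[𝓝 (extChartAt I x₀ x₀)] fieldRep I x₀ W →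
      lieBracketWithin ℝ v w t (extChartAt I x₀ x₀) =
        lieBracket ℝ (fieldRep I x₀ V) (fieldRep I x₀ W) (extChartAt I x₀ x₀) := by
    rintro v w t rfl hv hw
    rw [lieBracketWithin_univ]
    exact hv.lieBracket_vectorField_eq hw
  exact h5 _ _ _ (by rw [preimage_univ, univ_inter, I.range_eq_univ]) (key V) (key W)

end Charts

/-! ### Exterior derivative in a chart; tangent spaces of submanifolds -/

section Charts

variable {E : Type*} [NormedAddCommGroup E] [NormedSpace ℝ E]
  {H : Type*} [TopologicalSpace H] {I : ModelWithCorners ℝ E H}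
  {M : Type*} [TopologicalSpace M] [ChartedSpace H M] [IsManifold I ∞ M]

theorem fieldRep_localExtension_eventuallyEq [I.Boundaryless] {x : M} (v : TangentSpace I x) :
    fieldRep I x (localExtension I v) =ᶠ[𝓝 (extChartAt I x x)]
      fun _ => chartDeriv I x x v := by
  filter_upwards [extChartAt_target_mem_nhds (I := I) x] with p hp
  exact chartDeriv_localExtension ((extChartAt I x).map_target hp) v

theorem mlieBracket_localExtension [I.Boundaryless] {x : M} (v w : TangentSpace I x) :
    mlieBracket I (localExtension I v) (localExtension I w) x = 0 := by
  apply chartDeriv_injective (mem_extChartAt_source (I := I) x)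
  rw [chartDeriv_mlieBracket, map_zero,
    (fieldRep_localExtension_eventuallyEq v).lieBracket_vectorField_eq
      (fieldRep_localExtension_eventuallyEq w)]
  simp [lieBracket_eq]

/-- The extensions used by `extDerivOneForm` are constant in the chart at x, whereas θ is given in
the chart at x₀. The change of chart T therefore contributes a term in D²T, which antisymmetrisation
removes; the bracket of the constant extensions is zero. -/
theorem extDerivOneForm_eq_of_rep [I.Boundaryless] {x₀ x : M}
    (hx : x ∈ (extChartAt I x₀).source)
    {θ : Π x : M, TangentSpace I x → ℝ} {Θ : E → E →L[ℝ] ℝ}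
    (hΘ : DifferentiableAt ℝ Θ (extChartAt I x₀ x))
    (h : ∀ᶠ z in 𝓝 x, ∀ X, θ z X = Θ (extChartAt I x₀ z) (chartDeriv I x₀ z X))
    (X Y : TangentSpace I x) :
    extDerivOneForm I θ x X Y =
      fderiv ℝ Θ (extChartAt I x₀ x) (chartDeriv I x₀ x X) (chartDeriv I x₀ x Y)
        - fderiv ℝ Θ (extChartAt I x₀ x) (chartDeriv I x₀ x Y) (chartDeriv I x₀ x X) := by
  have hxx := mem_extChartAt_source (I := I) x
  set T : E → E := extChartAt I x₀ ∘ (extChartAt I x).symm with hTdef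
  set p : E := extChartAt I x x with hp
  have hTp : T p = extChartAt I x₀ x := congrArg (extChartAt I x₀) ((extChartAt I x).left_inv hxx)
  have hT : ContDiffAt ℝ ∞ T p := contDiffAt_chart_change hx hxx
  have hT1 : HasFDerivAt T (fderiv ℝ T p) p := (hT.differentiableAt (by simp)).hasFDerivAt
  have hT2 : HasFDerivAt (fderiv ℝ T) (fderiv ℝ (fderiv ℝ T) p) p :=
    ((hT.fderiv_right (m := 1) (by norm_cast)).differentiableAt (by simp)).hasFDerivAt
  have key : ∀ X Y : TangentSpace I x,
      mvfderiv I (fun y => θ y (localExtension I Y y)) x X =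
        fderiv ℝ Θ (T p) (fderiv ℝ T p (chartDeriv I x x X)) (fderiv ℝ T p (chartDeriv I x x Y))
          + Θ (T p) (fderiv ℝ (fderiv ℝ T) p (chartDeriv I x x X) (chartDeriv I x x Y)) := by
    intro X Y
    have hrep : (fun y => θ y (localExtension I Y y)) ∘ (extChartAt I x).symm =ᶠ[𝓝 p]
        fun q => Θ (T q) (fderiv ℝ T q (chartDeriv I x x Y)) := by
      filter_upwards [extChartAt_target_mem_nhds (I := I) x,
        extChartAt_symm_mem_of_eventually hxx h,
        extChartAt_symm_mem_of_eventually hxx (eventually_mem_extChartAt_source hx)]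
        with q hq h1 h2
      have hs := (extChartAt I x).map_target hq
      have h3 := chartDeriv_change h2 hs (localExtension I Y ((extChartAt I x).symm q))
      rw [chartDeriv_localExtension hs, (extChartAt I x).right_inv hq] at h3
      simp only [Function.comp_apply, h1, h3]
      rfl
    have hd : HasFDerivAt (fun q => Θ (T q) (fderiv ℝ T q (chartDeriv I x x Y))) _ p :=
      HasFDerivAt.clm_apply (HasFDerivAt.comp p (by rw [hTp]; exact hΘ.hasFDerivAt) hT1)
        (hT2.clm_apply (hasFDerivAt_const (chartDeriv I x x Y) p))
    have hd' := hd.congr_of_eventuallyEq hrep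
    rw [mvfderiv_eq_fderiv_rep hxx hd'.differentiableAt, hd'.fderiv, ← hTp]
    simp [add_comm]
  have hz : θ x (mlieBracket I (localExtension I X) (localExtension I Y) x) = 0 := by
    rw [mlieBracket_localExtension, h.self_of_nhds, map_zero, map_zero]
  have hsymm := (hT.isSymmSndFDerivAt (by
    simp only [minSmoothness_of_isRCLikeNormedField]; norm_cast)).eq
    (chartDeriv I x x X) (chartDeriv I x x Y)
  rw [extDerivOneForm, hz, key, key, hsymm, chartDeriv_change hx hxx X, chartDeriv_change hx hxx Y,
    ← hTp]
  ring

variable {F : Type*} [NormedAddCommGroup F] [NormedSpace ℝ F]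

/-- A subspace of a finite-dimensional space is the kernel of a continuous linear map. -/
theorem exists_clm_ker_eq [FiniteDimensional ℝ E] (L : Submodule ℝ E) :
    ∃ q : E →L[ℝ] E, ∀ v, v ∈ L ↔ q v = 0 := by
  obtain ⟨K, hK⟩ := L.exists_isCompl
  refine ⟨LinearMap.toContinuousLinearMap (K.subtype ∘ₗ K.projectionOnto L hK.symm), fun v => ?_⟩
  simp

omit [IsManifold I ∞ M] in
theorem hasDerivAt_comp_of_tangentMap_eq {c : ℝ → M} {y : M} {v : TangentSpace I y}
    (hc : MDifferentiableAt 𝓘(ℝ, ℝ) I c 0)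
    (h : tangentMap 𝓘(ℝ, ℝ) I c ⟨0, (1 : ℝ)⟩ = (⟨y, v⟩ : TangentBundle I M))
    {g : M → F} (hg : MDifferentiableAt I 𝓘(ℝ, F) g y) :
    c 0 = y ∧ HasDerivAt (g ∘ c) (mvfderiv I g y v) 0 := by
  have h0 : c 0 = y := congrArg TotalSpace.proj h
  refine ⟨h0, ?_⟩
  subst h0
  have hv : mfderiv 𝓘(ℝ, ℝ) I c 0 (1 : ℝ) = v := by
    simpa [tangentMap] using h
  subst hv
  have h1 : HasFDerivAt (g ∘ c) ((mvfderiv I g (c 0)) ∘L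
      (mfderiv 𝓘(ℝ, ℝ) I c 0 : ℝ →L[ℝ] TangentSpace I (c 0))) 0 :=
    (hg.hasMFDerivAt.comp (0 : ℝ) hc.hasMFDerivAt).hasFDerivAt
  exact h1.hasDerivAt

omit [IsManifold I ∞ M] in
theorem mvfderiv_extend_injective [I.Boundaryless] {φ : OpenPartialHomeomorph M H}
    (hφ : φ ∈ IsManifold.maximalAtlas I ∞ M) {y : M} (hy : y ∈ φ.source) :
    Function.Injective (mvfderiv I (φ.extend I) y) := by
  have h1 : MDifferentiableAt I 𝓘(ℝ, E) (φ.extend I) y :=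
    (φ.contMDiffAt_extend hφ hy).mdifferentiableAt (by simp)
  have ht : I '' φ.target ∈ 𝓝 (φ.extend I y) := by
    rw [← φ.extend_target']
    exact (φ.isOpen_extend_target).mem_nhds ((φ.extend I).map_source (by simpa using hy))
  have h2 : MDifferentiableAt 𝓘(ℝ, E) I (φ.extend I).symm (φ.extend I y) :=
    ((contMDiffOn_extend_symm hφ).contMDiffAt ht).mdifferentiableAt (by simp)
  have h3 := (h2.hasMFDerivAt).comp y h1.hasMFDerivAt
  have h4 : (φ.extend I).symm ∘ φ.extend I =ᶠ[𝓝 y] id := by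
    filter_upwards [φ.open_source.mem_nhds hy] with z hz
    exact (φ.extend I).left_inv (by simpa using hz)
  have h5 := h3.mfderiv
  rw [h4.mfderiv_eq, mfderiv_id] at h5
  intro v w hvw
  have h6 := congrArg (fun L => L v) h5
  have h7 := congrArg (fun L => L w) h5
  have h8 : mfderiv I 𝓘(ℝ, E) (φ.extend I) y v = mfderiv I 𝓘(ℝ, E) (φ.extend I) y w := hvw
  refine h6.trans (Eq.trans ?_ h7.symm)
  exact congrArg (mfderiv 𝓘(ℝ, E) I (φ.extend I).symm (φ.extend I y)) h8

omit [IsManifold I ∞ M] in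
-- A curve in P stays in the affine slice, so a linear map with kernel L is constant on it and its
-- velocity lies in L. Conversely a vector of L is the velocity of a straight segment in the slice
-- chart. The point y may differ from the centre x of the slice.
theorem mem_tangentSpaceOf_iff [FiniteDimensional ℝ E] [I.Boundaryless] {P : Set M} {x y : M}
    {φ : OpenPartialHomeomorph M H} (hφ : φ ∈ IsManifold.maximalAtlas I ∞ M)
    {L : Submodule ℝ E}
    (hL : ∀ y ∈ φ.source, (y ∈ P ↔ φ.extend I y - φ.extend I x ∈ L))
    (hy : y ∈ φ.source) (hyP : y ∈ P) (v : TangentSpace I y) :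
    v ∈ tangentSpaceOf I P y ↔ mvfderiv I (φ.extend I) y v ∈ L := by
  have hφy : MDifferentiableAt I 𝓘(ℝ, E) (φ.extend I) y :=
    (φ.contMDiffAt_extend hφ hy).mdifferentiableAt (by simp)
  obtain ⟨q, hq⟩ := exists_clm_ker_eq L
  constructor
  · suffices h : tangentSpaceOf I P y ≤
        L.comap (mvfderiv I (φ.extend I) y : TangentSpace I y →ₗ[ℝ] E) from fun hv => h hv
    refine Submodule.span_le.2 ?_
    rintro w ⟨ε, hε, c, hc, hcP, hw⟩
    have h0 : Ioo (-ε) ε ∈ 𝓝 (0 : ℝ) := Ioo_mem_nhds (by linarith) hε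
    have hcc : ContMDiffAt 𝓘(ℝ, ℝ) I ∞ c 0 := hc.contMDiffAt h0
    obtain ⟨hc0, hd⟩ := hasDerivAt_comp_of_tangentMap_eq (hcc.mdifferentiableAt (by simp)) hw hφy
    have hd2 := q.hasFDerivAt.comp_hasDerivAt (0 : ℝ) hd
    have hconst : q ∘ φ.extend I ∘ c =ᶠ[𝓝 0] fun _ => q (φ.extend I x) := by
      have hs : ∀ᶠ t in 𝓝 (0 : ℝ), c t ∈ φ.source :=
        hcc.continuousAt.eventually (φ.open_source.mem_nhds (by rwa [hc0]))
      filter_upwards [h0, hs] with t ht hts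
      have := (hq _).1 ((hL _ hts).1 (hcP t ht))
      rw [map_sub, sub_eq_zero] at this
      exact this
    have := (hd2.congr_of_eventuallyEq hconst.symm).unique (hasDerivAt_const _ _)
    exact (hq _).2 this
  · intro hv
    set l := mvfderiv I (φ.extend I) y v with hl
    have ht : (φ.extend I).target ∈ 𝓝 (φ.extend I y) :=
      (φ.isOpen_extend_target).mem_nhds ((φ.extend I).map_source (by simpa using hy))
    have hcont : ContDiff ℝ ∞ fun t : ℝ => φ.extend I y + t • l := by fun_prop
    have hev : ∀ᶠ t in 𝓝 (0 : ℝ), φ.extend I y + t • l ∈ (φ.extend I).target :=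
      (hcont.continuous.tendsto' 0 (φ.extend I y) (by simp)).eventually ht
    obtain ⟨ε, hε, hball⟩ := Metric.eventually_nhds_iff.1 hev
    have hmem : ∀ t ∈ Ioo (-ε) ε, φ.extend I y + t • l ∈ (φ.extend I).target := fun t ht' =>
      hball (by rw [dist_zero_right, Real.norm_eq_abs, abs_lt]; exact ht')
    let c : ℝ → M := fun t => (φ.extend I).symm (φ.extend I y + t • l)
    have hc0 : c 0 = y := by
      simp only [c, zero_smul, add_zero]
      exact (φ.extend I).left_inv (by simpa using hy)
    have hcs : ContMDiffOn 𝓘(ℝ, ℝ) I ∞ c (Ioo (-ε) ε) := by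
      refine (contMDiffOn_extend_symm hφ).comp hcont.contMDiff.contMDiffOn ?_
      intro t ht'
      rw [mem_preimage, ← φ.extend_target']
      exact hmem t ht'
    have hcd : MDifferentiableAt 𝓘(ℝ, ℝ) I c 0 :=
      (hcs.contMDiffAt (Ioo_mem_nhds (by linarith) hε)).mdifferentiableAt (by simp)
    refine Submodule.subset_span ⟨ε, hε, c, hcs, fun t ht' => ?_, ?_⟩
    · have hs : c t ∈ φ.source := by
        have := (φ.extend I).map_target (hmem t ht')
        rwa [φ.extend_source] at this
      rw [hL _ hs]
      simp only [c]
      rw [(φ.extend I).right_inv (hmem t ht'), add_sub_right_comm]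
      exact L.add_mem ((hL _ hy).1 hyP) (L.smul_mem _ hv)
    · have hw : tangentMap 𝓘(ℝ, ℝ) I c ⟨0, (1 : ℝ)⟩ =
          (⟨c 0, mfderiv 𝓘(ℝ, ℝ) I c 0 (1 : ℝ)⟩ : TangentBundle I M) := rfl
      have hd := (hasDerivAt_comp_of_tangentMap_eq hcd hw
        (g := φ.extend I) (by rwa [hc0])).2
      have hd2 : HasDerivAt (fun t : ℝ => φ.extend I y + t • l) l 0 := by
        simpa using ((hasDerivAt_id (0 : ℝ)).smul_const l).const_add (φ.extend I y)
      have hev2 : φ.extend I ∘ c =ᶠ[𝓝 0] fun t : ℝ => φ.extend I y + t • l := by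
        filter_upwards [hev] with t ht'
        exact (φ.extend I).right_inv ht'
      have heq := hd.unique (hd2.congr_of_eventuallyEq hev2)
      rw [hw]
      clear_value l
      clear hd hd2 hw
      -- The base point is generalised because `c 0 = y` holds only propositionally, so the two
      -- vectors live in formally different tangent spaces.
      have : ∀ (y' : M) (w : TangentSpace I y'), y' = y → mvfderiv I (φ.extend I) y' w = l →
          (⟨y', w⟩ : TangentBundle I M) = ⟨y, v⟩ := by
        rintro y' w rfl hw
        rw [mvfderiv_extend_injective hφ hy (hw.trans hl)]
      exact this _ _ hc0 heq

end Charts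

/-! ### Smooth fields in a chart; new charts from the inverse function theorem -/

section Charts

variable {E : Type*} [NormedAddCommGroup E] [NormedSpace ℝ E]
  {H : Type*} [TopologicalSpace H] {I : ModelWithCorners ℝ E H}
  {M : Type*} [TopologicalSpace M] [ChartedSpace H M] [IsManifold I ∞ M]

theorem contMDiffAt_field_iff [I.Boundaryless] {x₀ x : M} (hx : x ∈ (extChartAt I x₀).source)
    (X : Π x : M, TangentSpace I x) :
    ContMDiffAt I I.tangent ∞ (fun x => (⟨x, X x⟩ : TangentBundle I M)) x ↔
      ContDiffAt ℝ ∞ (fieldRep I x₀ X) (extChartAt I x₀ x) := by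
  have hxc : x ∈ (chartAt H x₀).source := by simpa using hx
  have hb : x ∈ (trivializationAt E (TangentSpace I) x₀).baseSet := by simpa using hx
  have h1 := (trivializationAt E (TangentSpace I) x₀).contMDiffAt_section_iff
    (IB := I) (n := ∞) (s := X) hb
  have h2 : (fun x => (trivializationAt E (TangentSpace I) x₀ ⟨x, X x⟩).2) =ᶠ[𝓝 x]
      fun x => chartDeriv I x₀ x (X x) := by
    filter_upwards [eventually_mem_extChartAt_source hx] with y hy
    exact trivializationAt_snd_eq_chartDeriv hy _
  have h3 : (fun x => chartDeriv I x₀ x (X x)) =ᶠ[𝓝 x]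
      fieldRep I x₀ X ∘ extChartAt I x₀ := by
    filter_upwards [eventually_mem_extChartAt_source hx] with y hy
    rw [Function.comp_apply, fieldRep, (extChartAt I x₀).left_inv hy]
  have ht : (extChartAt I x₀).target ∈ 𝓝 (extChartAt I x₀ x) :=
    extChartAt_target_mem_nhds' ((extChartAt I x₀).map_source hx)
  refine h1.trans ?_
  rw [h2.contMDiffAt_iff]
  constructor
  · intro h
    have h4 : ContMDiffAt 𝓘(ℝ, E) I ∞ (extChartAt I x₀).symm (extChartAt I x₀ x) :=
      (contMDiffOn_extChartAt_symm x₀).contMDiffAt ht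
    have h5 := ContMDiffAt.comp (extChartAt I x₀ x)
      (by rw [(extChartAt I x₀).left_inv hx]; exact h) h4
    exact h5.contDiffAt
  · intro h
    rw [h3.contMDiffAt_iff]
    exact h.contMDiffAt.comp x (contMDiffAt_extChartAt' hxc)

/-- A coordinate map with invertible derivative at one point becomes a chart of the maximal atlas
after shrinking. The predicate `p` allows shrinking further into any prescribed neighbourhood. -/
theorem exists_mem_maximalAtlas_of_rep [CompleteSpace E] [I.Boundaryless] {x₀ x : M}
    (hx : x ∈ (extChartAt I x₀).source) {Ψ : E → E} {U : Set E} (hU : IsOpen U)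
    (hxU : extChartAt I x₀ x ∈ U) (hΨ : ContDiffOn ℝ ∞ Ψ U)
    (hinv : (fderiv ℝ Ψ (extChartAt I x₀ x)).IsInvertible) {p : M → Prop}
    (hp : ∀ᶠ y in 𝓝 x, p y) :
    ∃ φ ∈ IsManifold.maximalAtlas I ∞ M, x ∈ φ.source ∧
      ∀ y ∈ φ.source, y ∈ (extChartAt I x₀).source ∧ p y ∧
        φ.extend I y = Ψ (extChartAt I x₀ y) := by
  obtain ⟨A, hA⟩ := hinv
  obtain ⟨W, hWp, hW, hxW⟩ := eventually_nhds_iff.1 hp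
  have hcd : ∀ q ∈ U, ContDiffAt ℝ ∞ Ψ q := fun q hq => hΨ.contDiffAt (hU.mem_nhds hq)
  have hdiff : ∀ q ∈ U, DifferentiableAt ℝ Ψ q := fun q hq =>
    (hcd q hq).differentiableAt (by simp)
  have hcont : ContinuousOn (fderiv ℝ Ψ) U := hΨ.continuousOn_fderiv_of_isOpen hU (by simp)
  -- Invertibility of DΨ is an open condition. Restricting to the set where it holds makes the local
  -- inverse smooth at every point of its domain, not only at the image of x.
  set U' : Set E := U ∩ fderiv ℝ Ψ ⁻¹' range ((↑) : (E ≃L[ℝ] E) → E →L[ℝ] E) with hU'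
  have hU'o : IsOpen U' := hcont.isOpen_inter_preimage hU ContinuousLinearEquiv.isOpen
  have hfd : HasFDerivAt Ψ (A : E →L[ℝ] E) (extChartAt I x₀ x) := by
    rw [hA]; exact (hdiff _ hxU).hasFDerivAt
  let G : OpenPartialHomeomorph E E :=
    ((hcd _ hxU).toOpenPartialHomeomorph Ψ hfd (by simp)).restrOpen U' hU'o
  have hGs : G.source ⊆ U' := by
    intro q hq
    exact hq.2
  have hxG : extChartAt I x₀ x ∈ G.source :=
    ⟨(hcd _ hxU).mem_toOpenPartialHomeomorph_source hfd (by simp), hxU, A, hA⟩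
  have hGc : ∀ q, G q = Ψ q := fun q => rfl
  have hGd : ∀ q ∈ G.target, ContDiffAt ℝ ∞ G.symm q := by
    intro q hq
    have hq' := hGs (G.map_target hq)
    obtain ⟨B, hB⟩ := hq'.2
    refine G.contDiffAt_symm (f₀' := B) hq ?_ (hcd _ hq'.1)
    rw [hB]
    exact (hdiff _ hq'.1).hasFDerivAt
  -- Without boundary, the model map is a homeomorphism from H onto E; it carries the E-valued map Ψ
  -- back to an H-valued chart.
  let T : OpenPartialHomeomorph H E := I.toHomeomorph.toOpenPartialHomeomorph
  let φ : OpenPartialHomeomorph M H :=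
    (((chartAt H x₀).restrOpen W hW).trans T).trans (G.trans T.symm)
  have hφs : ∀ y, y ∈ φ.source ↔
      (y ∈ (extChartAt I x₀).source ∧ y ∈ W) ∧ extChartAt I x₀ y ∈ G.source := by
    intro y
    simp [φ, T]
  have hφe : ∀ y, φ y = I.symm (Ψ (extChartAt I x₀ y)) := fun y => rfl
  have hr : range I = univ := I.range_eq_univ
  refine ⟨φ, OpenPartialHomeomorph.mem_maximalAtlas_of_contMDiffOn φ ?_ ?_,
    (hφs x).2 ⟨⟨hx, hxW⟩, hxG⟩, ?_⟩
  · intro y hy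
    obtain ⟨⟨hy1, hy2⟩, hy3⟩ := (hφs y).1 hy
    have h1 : ContMDiffAt I 𝓘(ℝ, E) ∞ (extChartAt I x₀) y :=
      contMDiffAt_extChartAt' (by simpa using hy1)
    have h2 := ((hcd _ (hGs hy3).1).contMDiffAt.comp y h1)
    have h3 : ContMDiffAt 𝓘(ℝ, E) I ∞ I.symm ((Ψ ∘ extChartAt I x₀) y) :=
      I.contMDiffOn_symm.contMDiffAt (by rw [hr]; exact Filter.univ_mem)
    exact (h3.comp y h2).contMDiffWithinAt
  · intro z hz
    have hz1 : I z ∈ G.target := by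
      have := hz.1
      simp [T] at this
      exact this
    have hz2 : G.symm (I z) ∈ (extChartAt I x₀).target := by
      have h := (φ.map_target hz)
      have h' := ((hφs _).1 h).1.1
      have h3 := (extChartAt I x₀).map_source h'
      have h4 := φ.right_inv hz
      rw [hφe] at h4
      have h5 : Ψ (extChartAt I x₀ (φ.symm z)) = I z := by
        have := congrArg I h4
        rwa [I.right_inv (by rw [hr]; trivial)] at this
      rw [← h5, ← hGc, G.left_inv ((hφs _).1 h).2]
      exact h3
    have h1 := (hGd _ hz1).contMDiffAt.comp z (I.contMDiff z)
    have h2 : ContMDiffAt 𝓘(ℝ, E) I ∞ (extChartAt I x₀).symm ((G.symm ∘ I) z) :=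
      (contMDiffOn_extChartAt_symm x₀).contMDiffAt (extChartAt_target_mem_nhds' hz2)
    exact (h2.comp z h1).contMDiffWithinAt
  · intro y hy
    obtain ⟨⟨hy1, hy2⟩, hy3⟩ := (hφs y).1 hy
    refine ⟨hy1, hWp y hy2, ?_⟩
    rw [φ.extend_coe, Function.comp_apply, hφe, I.right_inv (by rw [hr]; trivial)]

omit [IsManifold I ∞ M] in
theorem contDiffOn_extend_comp_chart_symm {φ : OpenPartialHomeomorph M H} [IsManifold I ∞ M]
    [I.Boundaryless] (hφ : φ ∈ IsManifold.maximalAtlas I ∞ M) (x₀ : M) :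
    IsOpen ((extChartAt I x₀).target ∩ (extChartAt I x₀).symm ⁻¹' φ.source) ∧
    ContDiffOn ℝ ∞ (φ.extend I ∘ (extChartAt I x₀).symm)
      ((extChartAt I x₀).target ∩ (extChartAt I x₀).symm ⁻¹' φ.source) := by
  refine ⟨(continuousOn_extChartAt_symm x₀).isOpen_inter_preimage (isOpen_extChartAt_target x₀)
    φ.open_source, ?_⟩
  have h := (φ.contMDiffOn_extend hφ).comp
    ((contMDiffOn_extChartAt_symm (I := I) (n := ∞) x₀).mono inter_subset_left)
    (fun q hq => hq.2)
  exact h.contDiffOn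

end Charts

/-! ### Finsler calculus in coordinates: energy, spray, nonlinear connection -/

section Energy

variable {V : Type*} [NormedAddCommGroup V] [NormedSpace ℝ V]

/-- The coordinate expression of the energy of a Finsler metric over an open set `Ω`. -/
structure IsEnergyOn (e : V × V → ℝ) (Ω : Set (V × V)) : Prop where
  isOpen : IsOpen Ω
  contDiffOn : ContDiffOn ℝ ∞ e Ω
  euler : ∀ p ∈ Ω, fderiv ℝ e p (0, p.2) = 2 * e p
  pos : ∀ p ∈ Ω, ∀ a : V, a ≠ 0 → 0 < fderiv ℝ (fderiv ℝ e) p (0, a) (0, a)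

/-- The vertical Hessian of `e` as a map `V → V*`. -/
def vertHess (e : V × V → ℝ) (p : V × V) : V →L[ℝ] V →L[ℝ] ℝ :=
  (ContinuousLinearMap.precomp ℝ (ContinuousLinearMap.inr ℝ V V)) ∘L
    (fderiv ℝ (fderiv ℝ e) p) ∘L (ContinuousLinearMap.inr ℝ V V)

@[simp] theorem vertHess_apply (e : V × V → ℝ) (p : V × V) (a b : V) :
    vertHess e p a b = fderiv ℝ (fderiv ℝ e) p (0, a) (0, b) := rfl

/-- The right-hand side of the geodesic equation. -/
def sprayForce (e : V × V → ℝ) (p : V × V) : V →L[ℝ] ℝ :=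
  (fderiv ℝ e p) ∘L (ContinuousLinearMap.inl ℝ V V) -
    (fderiv ℝ (fderiv ℝ e) p (p.2, 0)) ∘L (ContinuousLinearMap.inr ℝ V V)

/-- The vertical component of the geodesic spray. -/
def sprayVec (e : V × V → ℝ) (p : V × V) : V := (vertHess e p).inverse (sprayForce e p)

/-- The coefficients of the canonical nonlinear connection. -/
def nonlinConn (e : V × V → ℝ) (p : V × V) (c : V) : V :=
  -(1 / 2 : ℝ) • fderiv ℝ (sprayVec e) p (0, c)

namespace IsEnergyOn

variable {e : V × V → ℝ} {Ω : Set (V × V)} (h : IsEnergyOn e Ω)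

include h

theorem contDiffAt {p : V × V} (hp : p ∈ Ω) : ContDiffAt ℝ ∞ e p :=
  h.contDiffOn.contDiffAt (h.isOpen.mem_nhds hp)

theorem contDiffAt_fderiv {p : V × V} (hp : p ∈ Ω) : ContDiffAt ℝ ∞ (fderiv ℝ e) p :=
  (h.contDiffAt hp).fderiv_right (by simp)

theorem contDiffAt_fderiv_fderiv {p : V × V} (hp : p ∈ Ω) :
    ContDiffAt ℝ ∞ (fderiv ℝ (fderiv ℝ e)) p :=
  (h.contDiffAt_fderiv hp).fderiv_right (by simp)

theorem hasFDerivAt {p : V × V} (hp : p ∈ Ω) : HasFDerivAt e (fderiv ℝ e p) p :=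
  ((h.contDiffAt hp).differentiableAt (by simp)).hasFDerivAt

theorem hasFDerivAt_fderiv {p : V × V} (hp : p ∈ Ω) :
    HasFDerivAt (fderiv ℝ e) (fderiv ℝ (fderiv ℝ e) p) p :=
  ((h.contDiffAt_fderiv hp).differentiableAt (by simp)).hasFDerivAt

theorem hasFDerivAt_fderiv_fderiv {p : V × V} (hp : p ∈ Ω) :
    HasFDerivAt (fderiv ℝ (fderiv ℝ e)) (fderiv ℝ (fderiv ℝ (fderiv ℝ e)) p) p :=
  ((h.contDiffAt_fderiv_fderiv hp).differentiableAt (by simp)).hasFDerivAt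

theorem eventually_mem {p : V × V} (hp : p ∈ Ω) : ∀ᶠ q in 𝓝 p, q ∈ Ω := h.isOpen.mem_nhds hp

theorem symm {p : V × V} (hp : p ∈ Ω) (X Y : V × V) :
    fderiv ℝ (fderiv ℝ e) p X Y = fderiv ℝ (fderiv ℝ e) p Y X :=
  ((h.contDiffAt hp).isSymmSndFDerivAt (by
    simp only [minSmoothness_of_isRCLikeNormedField]; norm_cast)).eq X Y

theorem euler_deriv {p : V × V} (hp : p ∈ Ω) (X : V × V) :
    fderiv ℝ (fderiv ℝ e) p X (0, p.2) = 2 * fderiv ℝ e p X - fderiv ℝ e p (0, X.2) := by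
  have h1 : HasFDerivAt (fun q : V × V => ((0, q.2) : V × V))
      ((ContinuousLinearMap.inr ℝ V V) ∘L (ContinuousLinearMap.snd ℝ V V)) p :=
    ((ContinuousLinearMap.inr ℝ V V) ∘L (ContinuousLinearMap.snd ℝ V V)).hasFDerivAt
  have h2 := (h.hasFDerivAt_fderiv hp).clm_apply h1
  have h3 : (fun q : V × V => fderiv ℝ e q (0, q.2)) =ᶠ[𝓝 p] fun q => 2 * e q := by
    filter_upwards [h.eventually_mem hp] with q hq using h.euler q hq
  have h4 := (h2.congr_of_eventuallyEq h3.symm).unique ((h.hasFDerivAt hp).const_mul 2)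
  have h5 := congrArg (fun L => L X) h4
  simp at h5
  linarith

theorem vertical_euler {p : V × V} (hp : p ∈ Ω) (a : V) :
    fderiv ℝ (fderiv ℝ e) p (0, a) (0, p.2) = fderiv ℝ e p (0, a) := by
  rw [h.euler_deriv hp]; ring

theorem vertHess_injective {p : V × V} (hp : p ∈ Ω) : Function.Injective (vertHess e p) := by
  rw [injective_iff_map_eq_zero]
  intro a ha
  by_contra hne
  have := h.pos p hp a hne
  rw [← vertHess_apply, ha] at this
  simp at this

theorem eq_zero_of_forall {p : V × V} (hp : p ∈ Ω) {a : V}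
    (ha : ∀ b, fderiv ℝ (fderiv ℝ e) p (0, a) (0, b) = 0) : a = 0 := by
  by_contra hne
  exact (h.pos p hp a hne).ne' (ha a)

variable [FiniteDimensional ℝ V]

theorem vertHess_isInvertible {p : V × V} (hp : p ∈ Ω) : (vertHess e p).IsInvertible := by
  have hfd : Module.finrank ℝ V = Module.finrank ℝ (V →L[ℝ] ℝ) := by
    rw [← (LinearMap.toContinuousLinearMap (𝕜 := ℝ) (E := V) (F' := ℝ)).finrank_eq]
    exact (Subspace.dual_finrank_eq (K := ℝ) (V := V)).symm
  refine ⟨(LinearEquiv.ofInjectiveOfFinrankEq (vertHess e p : V →ₗ[ℝ] V →L[ℝ] ℝ)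
    (h.vertHess_injective hp) hfd).toContinuousLinearEquiv, ?_⟩
  ext a b
  rfl

theorem exists_vertHess_eq {p : V × V} (hp : p ∈ Ω) (f : V →L[ℝ] ℝ) :
    ∃ a, ∀ b, fderiv ℝ (fderiv ℝ e) p (0, a) (0, b) = f b := by
  obtain ⟨A, hA⟩ := h.vertHess_isInvertible hp
  refine ⟨A.symm f, fun b => ?_⟩
  rw [← vertHess_apply, ← hA]
  simp

/-- The Euler–Lagrange equation of e, in which `sprayVec` is the acceleration: it solves for the
vertical component by inverting the vertical Hessian. -/
theorem spray_eq {p : V × V} (hp : p ∈ Ω) (a : V) :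
    fderiv ℝ (fderiv ℝ e) p (p.2, sprayVec e p) (0, a) = fderiv ℝ e p (a, 0) := by
  have h1 := congrArg (fun f => f a) ((h.vertHess_isInvertible hp).self_apply_inverse (sprayForce e p))
  have h2 : ((p.2, sprayVec e p) : V × V) = (p.2, 0) + (0, sprayVec e p) := by simp
  have h3 : fderiv ℝ (fderiv ℝ e) p (0, sprayVec e p) (0, a) = sprayForce e p a := h1
  rw [h2, map_add, add_apply, h3]
  simp [sprayForce]

theorem differentiableAt_sprayVec {p : V × V} (hp : p ∈ Ω) :
    DifferentiableAt ℝ (sprayVec e) p := by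
  have h1 : DifferentiableAt ℝ (vertHess e) p := by
    unfold vertHess
    exact (differentiableAt_const _).clm_comp
      ((h.hasFDerivAt_fderiv_fderiv hp).differentiableAt.clm_comp (differentiableAt_const _))
  have h2 : DifferentiableAt ℝ (sprayForce e) p := by
    unfold sprayForce
    have h3 : DifferentiableAt ℝ (fun q : V × V => ((q.2, 0) : V × V)) p :=
      ((ContinuousLinearMap.inl ℝ V V) ∘L
        (ContinuousLinearMap.snd ℝ V V)).hasFDerivAt.differentiableAt
    exact ((h.hasFDerivAt_fderiv hp).differentiableAt.clm_comp (differentiableAt_const _)).sub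
      (((h.hasFDerivAt_fderiv_fderiv hp).differentiableAt.clm_apply h3).clm_comp
        (differentiableAt_const _))
  obtain ⟨A, hA⟩ := h.vertHess_isInvertible hp
  have h4 : DifferentiableAt ℝ ContinuousLinearMap.inverse (vertHess e p) := by
    rw [← hA]
    exact (contDiffAt_map_inverse (n := 1) A).differentiableAt (by simp)
  have h5 := DifferentiableAt.comp (𝕜 := ℝ) (g := ContinuousLinearMap.inverse)
    (f := vertHess e) p h4 h1
  have h6 := h5.clm_apply h2
  exact h6

/-- The derivative of the geodesic equation `spray_eq` in the vertical direction c. The derivative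
of the spray along (0, c) is −2N(c), which is the source of the factor 2. -/
theorem nonlinConn_eq {p : V × V} (hp : p ∈ Ω) (c a : V) :
    fderiv ℝ (fderiv ℝ e) p (c, 0) (0, a)
        - 2 * fderiv ℝ (fderiv ℝ e) p (0, nonlinConn e p c) (0, a) =
      fderiv ℝ (fderiv ℝ e) p (0, c) (a, 0)
        - fderiv ℝ (fderiv ℝ (fderiv ℝ e)) p (p.2, sprayVec e p) (0, c) (0, a) := by
  have hS : HasFDerivAt (fun q : V × V => ((q.2, sprayVec e q) : V × V))
      ((ContinuousLinearMap.snd ℝ V V).prod (fderiv ℝ (sprayVec e) p)) p :=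
    (ContinuousLinearMap.snd ℝ V V).hasFDerivAt.prodMk (h.differentiableAt_sprayVec hp).hasFDerivAt
  have h1 := ((h.hasFDerivAt_fderiv_fderiv hp).clm_apply hS).clm_apply
    (hasFDerivAt_const ((0, a) : V × V) p)
  have h2 := (h.hasFDerivAt_fderiv hp).clm_apply (hasFDerivAt_const ((a, 0) : V × V) p)
  have h3 : (fun q : V × V => fderiv ℝ (fderiv ℝ e) q (q.2, sprayVec e q) (0, a)) =ᶠ[𝓝 p]
      fun q => fderiv ℝ e q (a, 0) := by
    filter_upwards [h.eventually_mem hp] with q hq using h.spray_eq hq a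
  have h4 := congrArg (fun L => L ((0, c) : V × V)) ((h1.congr_of_eventuallyEq h3.symm).unique h2)
  have hsymm := ((h.contDiffAt_fderiv hp).isSymmSndFDerivAt (by
    simp only [minSmoothness_of_isRCLikeNormedField]; norm_cast)).eq (0, c) (p.2, sprayVec e p)
  have h5 : ((c, fderiv ℝ (sprayVec e) p (0, c)) : V × V) =
      (c, 0) - (2 : ℝ) • (0, nonlinConn e p c) := by
    simp [nonlinConn, smul_smul]
  have h6 := congrArg (fun X => fderiv ℝ (fderiv ℝ e) p X ((0, a) : V × V)) h5
  simp only [map_sub, map_smul, sub_apply, smul_apply, smul_eq_mul] at h6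
  simp [hsymm] at h4
  linarith

omit [FiniteDimensional ℝ V] in
theorem third_symm {p : V × V} (hp : p ∈ Ω) (X Y Z : V × V) :
    fderiv ℝ (fderiv ℝ (fderiv ℝ e)) p X Y Z = fderiv ℝ (fderiv ℝ (fderiv ℝ e)) p X Z Y := by
  have h1 := ((h.hasFDerivAt_fderiv_fderiv hp).clm_apply
    (hasFDerivAt_const Y p)).clm_apply (hasFDerivAt_const Z p)
  have h2 := ((h.hasFDerivAt_fderiv_fderiv hp).clm_apply
    (hasFDerivAt_const Z p)).clm_apply (hasFDerivAt_const Y p)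
  have h3 : (fun q => fderiv ℝ (fderiv ℝ e) q Y Z) =ᶠ[𝓝 p]
      fun q => fderiv ℝ (fderiv ℝ e) q Z Y := by
    filter_upwards [h.eventually_mem hp] with q hq using h.symm hq Y Z
  have h4 := congrArg (fun L => L X) ((h1.congr_of_eventuallyEq h3.symm).unique h2)
  simpa using h4

/-- Exchange c and a in `nonlinConn_eq` and subtract: the third-order terms are symmetric and
cancel, and the rest is twice the claim. Geometrically, horizontal spaces are isotropic for the
symplectic form. -/
theorem nonlinConn_antisymm {p : V × V} (hp : p ∈ Ω) (c a : V) :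
    fderiv ℝ (fderiv ℝ e) p (c, 0) (0, a) - fderiv ℝ (fderiv ℝ e) p (a, 0) (0, c) =
      fderiv ℝ (fderiv ℝ e) p (0, nonlinConn e p c) (0, a)
        - fderiv ℝ (fderiv ℝ e) p (0, nonlinConn e p a) (0, c) := by
  have h1 := h.nonlinConn_eq hp c a
  have h2 := h.nonlinConn_eq hp a c
  rw [h.third_symm hp _ (0, a) (0, c), h.symm hp (0, a) (c, 0)] at h2
  rw [h.symm hp (0, c) (a, 0)] at h1
  linarith

/-- The left side is dE = ω_F(X, ·) in coordinates. The spray solves it by Euler's relation and the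
geodesic equation. For uniqueness, vertical test vectors determine the first component of X, then
horizontal ones determine the second, each time by definiteness of the vertical Hessian. -/
theorem spray_unique {p : V × V} (hp : p ∈ Ω) (X : V × V) :
    (∀ Y, fderiv ℝ e p Y =
      fderiv ℝ (fderiv ℝ e) p Y (0, X.1) - fderiv ℝ (fderiv ℝ e) p X (0, Y.1)) ↔
      X = (p.2, sprayVec e p) := by
  have hsol : ∀ Y, fderiv ℝ e p Y = fderiv ℝ (fderiv ℝ e) p Y (0, p.2)
      - fderiv ℝ (fderiv ℝ e) p (p.2, sprayVec e p) (0, Y.1) := by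
    intro Y
    have hY : fderiv ℝ e p Y = fderiv ℝ e p (Y.1, 0) + fderiv ℝ e p (0, Y.2) := by
      rw [← map_add]; simp
    rw [h.euler_deriv hp, h.spray_eq hp, hY]
    ring
  constructor
  · intro hX
    have hd : ∀ Y, fderiv ℝ (fderiv ℝ e) p Y (0, X.1 - p.2)
        - fderiv ℝ (fderiv ℝ e) p (X - (p.2, sprayVec e p)) (0, Y.1) = 0 := by
      intro Y
      have h1 : ((0, X.1 - p.2) : V × V) = (0, X.1) - (0, p.2) := by simp
      rw [h1, map_sub, map_sub, sub_apply]
      linarith [hX Y, hsol Y]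
    have h1 : X.1 - p.2 = 0 := h.eq_zero_of_forall hp fun b => by
      have := hd (0, b)
      rw [h.symm hp]
      simp only [Prod.mk_zero_zero, map_zero, sub_zero] at this
      simpa using this
    have h2 : X.2 - sprayVec e p = 0 := h.eq_zero_of_forall hp fun b => by
      have := hd (b, 0)
      have h3 : X - (p.2, sprayVec e p) = (0, X.2 - sprayVec e p) := by
        ext1
        · exact h1
        · rfl
      rw [h1, h3] at this
      simp only [Prod.mk_zero_zero, map_zero, zero_sub] at this
      simpa using this
    ext1
    · exact sub_eq_zero.1 h1
    · exact sub_eq_zero.1 h2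
  · rintro rfl
    exact hsol

end IsEnergyOn

end Energy

/-! ### The tangent bundle in charts: projection, vertical lift, almost-tangent structure -/

section TangentCharts

variable {E : Type*} [NormedAddCommGroup E] [NormedSpace ℝ E]
  {M : Type*} [TopologicalSpace M] [ChartedSpace E M] [IsManifold 𝓘(ℝ, E) ∞ M]

theorem mem_tangent_extChartAt_source {w₀ z : TM E M} :
    z ∈ (extChartAt 𝓘(ℝ, E).tangent w₀).source ↔
      z.proj ∈ (extChartAt 𝓘(ℝ, E) w₀.proj).source := by
  rw [extChartAt_source, extChartAt_source]
  exact TangentBundle.mem_chart_source_iff z w₀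

theorem tangent_extChartAt_target (w₀ : TM E M) :
    (extChartAt 𝓘(ℝ, E).tangent w₀).target =
      (extChartAt 𝓘(ℝ, E) w₀.proj).target ×ˢ (univ : Set E) := by
  have h := FiberBundle.extChartAt_target (IB := 𝓘(ℝ, E)) (F := E) (E := TangentSpace 𝓘(ℝ, E)) w₀
  rw [inter_eq_left.2] at h
  · exact h
  · intro p hp
    have := (extChartAt 𝓘(ℝ, E) w₀.proj).map_target hp
    rw [extChartAt_source] at this
    exact this

theorem tangent_extChartAt_apply {w₀ z : TM E M}
    (hz : z.proj ∈ (extChartAt 𝓘(ℝ, E) w₀.proj).source) :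
    extChartAt 𝓘(ℝ, E).tangent w₀ z =
      (extChartAt 𝓘(ℝ, E) w₀.proj z.proj, chartDeriv 𝓘(ℝ, E) w₀.proj z.proj z.2) := by
  rw [← trivializationAt_snd_eq_chartDeriv hz]
  have h := FiberBundle.extChartAt (IB := 𝓘(ℝ, E)) w₀
  have h2 := congrArg (fun e : PartialEquiv (TM E M) (E × E) => e z) h
  exact h2

theorem tangent_extChartAt_symm_proj {w₀ : TM E M} {p : E × E}
    (hp : p.1 ∈ (extChartAt 𝓘(ℝ, E) w₀.proj).target) :
    ((extChartAt 𝓘(ℝ, E).tangent w₀).symm p).proj =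
      (extChartAt 𝓘(ℝ, E) w₀.proj).symm p.1 := by
  have hp' : p ∈ (extChartAt 𝓘(ℝ, E).tangent w₀).target := by
    rw [tangent_extChartAt_target]; exact ⟨hp, trivial⟩
  have hs := mem_tangent_extChartAt_source.1 ((extChartAt 𝓘(ℝ, E).tangent w₀).map_target hp')
  have h := (extChartAt 𝓘(ℝ, E).tangent w₀).right_inv hp'
  rw [tangent_extChartAt_apply hs] at h
  rw [← (extChartAt 𝓘(ℝ, E) w₀.proj).left_inv hs, ← congrArg Prod.fst h]

theorem chartDeriv_dpi {w₀ z : TM E M}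
    (hz : z.proj ∈ (extChartAt 𝓘(ℝ, E) w₀.proj).source) (X : TTM z) :
    chartDeriv 𝓘(ℝ, E) w₀.proj z.proj (dpi z X) =
      (chartDeriv 𝓘(ℝ, E).tangent w₀ z X).1 := by
  have hz' := mem_tangent_extChartAt_source.2 hz
  set f : TM E M → E := fun z => extChartAt 𝓘(ℝ, E) w₀.proj z.proj with hf
  have hrep : f ∘ (extChartAt 𝓘(ℝ, E).tangent w₀).symm =ᶠ[𝓝 (extChartAt 𝓘(ℝ, E).tangent w₀ z)]
      Prod.fst := by
    filter_upwards [extChartAt_target_mem_nhds'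
      ((extChartAt 𝓘(ℝ, E).tangent w₀).map_source hz')] with p hp
    have hp1 : p.1 ∈ (extChartAt 𝓘(ℝ, E) w₀.proj).target := by
      rw [tangent_extChartAt_target] at hp; exact hp.1
    rw [Function.comp_apply, hf]
    simp only
    rw [tangent_extChartAt_symm_proj hp1, PartialEquiv.right_inv _ hp1]
  have hd := (hasFDerivAt_fst (𝕜 := ℝ) (p :=
    extChartAt 𝓘(ℝ, E).tangent w₀ z)).congr_of_eventuallyEq hrep
  have h1 := mvfderiv_eq_fderiv_rep hz' hd.differentiableAt X
  rw [hd.fderiv] at h1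
  have h2 : MDifferentiableAt 𝓘(ℝ, E) 𝓘(ℝ, E) (extChartAt 𝓘(ℝ, E) w₀.proj) z.proj :=
    mdifferentiableAt_extChartAt (by simpa using hz)
  have h3 : MDifferentiableAt 𝓘(ℝ, E).tangent 𝓘(ℝ, E) (fun z : TM E M => z.proj) z :=
    (contMDiffAt_proj (n := 1) (F := E) (E := TangentSpace 𝓘(ℝ, E))).mdifferentiableAt (by simp)
  have h4 := congrArg (fun L => L X) (mfderiv_comp z h2 h3)
  exact h4.symm.trans h1

theorem chartDeriv_vlift {w₀ z : TM E M}
    (hz : z.proj ∈ (extChartAt 𝓘(ℝ, E) w₀.proj).source) (u : TangentSpace 𝓘(ℝ, E) z.proj) :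
    chartDeriv 𝓘(ℝ, E).tangent w₀ z (vlift z u) =
      (0, chartDeriv 𝓘(ℝ, E) w₀.proj z.proj u) := by
  have hz' := mem_tangent_extChartAt_source.2 hz
  set γ : ℝ → TM E M := fun t => ⟨z.proj, z.2 + t • u⟩ with hγ
  set B := chartDeriv 𝓘(ℝ, E) w₀.proj z.proj with hB
  have hγΦ : ∀ t, extChartAt 𝓘(ℝ, E).tangent w₀ (γ t) =
      (extChartAt 𝓘(ℝ, E) w₀.proj z.proj, B z.2 + t • B u) := by
    intro t
    have h := tangent_extChartAt_apply (w₀ := w₀) (z := γ t) hz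
    rw [h]
    simp only [hγ]
    rw [map_add, map_smul]
  have hγ2 : γ = fun t => (extChartAt 𝓘(ℝ, E).tangent w₀).symm
      (extChartAt 𝓘(ℝ, E) w₀.proj z.proj, B z.2 + t • B u) := by
    funext t
    rw [← hγΦ]
    exact (PartialEquiv.left_inv _
      ((mem_tangent_extChartAt_source (z := γ t)).2 hz)).symm
  have hcd : ContDiff ℝ ∞ fun t : ℝ =>
      ((extChartAt 𝓘(ℝ, E) w₀.proj z.proj, B z.2 + t • B u) : E × E) := by fun_prop
  have hγd : MDifferentiableAt 𝓘(ℝ, ℝ) 𝓘(ℝ, E).tangent γ 0 := by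
    have h1 : ContMDiffAt 𝓘(ℝ, E × E) 𝓘(ℝ, E).tangent ∞ (extChartAt 𝓘(ℝ, E).tangent w₀).symm
        (extChartAt 𝓘(ℝ, E) w₀.proj z.proj, B z.2 + (0 : ℝ) • B u) := by
      refine (contMDiffOn_extChartAt_symm w₀).contMDiffAt (extChartAt_target_mem_nhds' ?_)
      rw [tangent_extChartAt_target]
      exact ⟨(extChartAt 𝓘(ℝ, E) w₀.proj).map_source hz, trivial⟩
    have h2 : ContMDiffAt 𝓘(ℝ, ℝ) 𝓘(ℝ, E × E) ∞ (fun t : ℝ =>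
      ((extChartAt 𝓘(ℝ, E) w₀.proj z.proj, B z.2 + t • B u) : E × E)) 0 :=
      hcd.contMDiff.contMDiffAt
    rw [hγ2]
    exact (h1.comp (0 : ℝ) h2).mdifferentiableAt (by simp)
  have hγ0 : γ 0 = z := by simp [hγ]
  have ht : tangentMap 𝓘(ℝ, ℝ) 𝓘(ℝ, E).tangent γ ⟨0, (1 : ℝ)⟩ =
      (⟨z, vlift z u⟩ : TangentBundle 𝓘(ℝ, E).tangent (TM E M)) := by
    refine TotalSpace.ext hγ0 ?_
    exact HEq.rfl
  have hΦd : MDifferentiableAt 𝓘(ℝ, E).tangent 𝓘(ℝ, E × E)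
      (extChartAt 𝓘(ℝ, E).tangent w₀) z :=
    mdifferentiableAt_extChartAt (by simpa using hz')
  have h1 := (hasDerivAt_comp_of_tangentMap_eq hγd ht hΦd).2
  have h2 : HasDerivAt (fun t : ℝ =>
      ((extChartAt 𝓘(ℝ, E) w₀.proj z.proj, B z.2 + t • B u) : E × E)) (0, B u) 0 := by
    refine (hasDerivAt_const _ _).prodMk ?_
    simpa using ((hasDerivAt_id (0 : ℝ)).smul_const (B u)).const_add (B z.2)
  refine h1.unique (h2.congr_of_eventuallyEq ?_)
  filter_upwards with t using hγΦ t

theorem vlift_injective (w : TM E M) : Function.Injective (vlift w) := by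
  intro u v huv
  have h := mem_extChartAt_source (I := 𝓘(ℝ, E)) w.proj
  apply chartDeriv_injective h
  have h1 := congrArg (chartDeriv 𝓘(ℝ, E).tangent w w) huv
  rw [chartDeriv_vlift h, chartDeriv_vlift h] at h1
  exact congrArg Prod.snd h1

theorem vliftInv_vlift (w : TM E M) (u : TangentSpace 𝓘(ℝ, E) w.proj) :
    vliftInv w (vlift w u) = u :=
  Function.leftInverse_invFun (vlift_injective w) u

theorem eq_vlift_iff {w₀ z : TM E M}
    (hz : z.proj ∈ (extChartAt 𝓘(ℝ, E) w₀.proj).source) (X : TTM z)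
    (u : TangentSpace 𝓘(ℝ, E) z.proj) :
    X = vlift z u ↔ chartDeriv 𝓘(ℝ, E).tangent w₀ z X =
      (0, chartDeriv 𝓘(ℝ, E) w₀.proj z.proj u) := by
  rw [← chartDeriv_vlift hz]
  exact (chartDeriv_injective (mem_tangent_extChartAt_source.2 hz)).eq_iff.symm

theorem chartDeriv_vliftInv {w₀ z : TM E M}
    (hz : z.proj ∈ (extChartAt 𝓘(ℝ, E) w₀.proj).source) {X : TTM z}
    (hX : (chartDeriv 𝓘(ℝ, E).tangent w₀ z X).1 = 0) :
    chartDeriv 𝓘(ℝ, E) w₀.proj z.proj (vliftInv z X) =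
      (chartDeriv 𝓘(ℝ, E).tangent w₀ z X).2 := by
  obtain ⟨u, hu⟩ := chartDeriv_surjective hz (chartDeriv 𝓘(ℝ, E).tangent w₀ z X).2
  have h : X = vlift z u := by
    rw [eq_vlift_iff hz, hu]
    ext1
    · exact hX
    · rfl
  conv_lhs => rw [h, vliftInv_vlift]
  exact hu

theorem chartDeriv_almostTangent {w₀ z : TM E M}
    (hz : z.proj ∈ (extChartAt 𝓘(ℝ, E) w₀.proj).source) (X : TTM z) :
    chartDeriv 𝓘(ℝ, E).tangent w₀ z (almostTangent z X) =
      (0, (chartDeriv 𝓘(ℝ, E).tangent w₀ z X).1) := by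
  rw [almostTangent, chartDeriv_vlift hz, chartDeriv_dpi hz]

theorem mem_slit_iff {w₀ z : TM E M} (hz : z.proj ∈ (extChartAt 𝓘(ℝ, E) w₀.proj).source) :
    z ∈ slit E M ↔ (extChartAt 𝓘(ℝ, E).tangent w₀ z).2 ≠ 0 := by
  rw [tangent_extChartAt_apply hz]
  exact not_congr (map_eq_zero_iff _ (chartDeriv_injective hz)).symm

end TangentCharts

theorem deriv_deriv_line {W : Type*} [NormedAddCommGroup W] [NormedSpace ℝ W] {e : W → ℝ}
    {Ω : Set W} (hO : IsOpen Ω) (he : ContDiffOn ℝ ∞ e Ω) {p : W} (hp : p ∈ Ω) (X Y : W) :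
    deriv (fun t : ℝ => deriv (fun s : ℝ => 2 * e (p + t • Y + s • X)) 0) 0 =
      2 * fderiv ℝ (fderiv ℝ e) p Y X := by
  have hcd : ∀ q ∈ Ω, ContDiffAt ℝ ∞ e q := fun q hq => he.contDiffAt (hO.mem_nhds hq)
  have hline : ∀ (q X : W), HasDerivAt (fun s : ℝ => q + s • X) X 0 := fun q X => by
    simpa using ((hasDerivAt_id (0 : ℝ)).smul_const X).const_add q
  have h2 : (fun t : ℝ => deriv (fun s : ℝ => 2 * e (p + t • Y + s • X)) 0) =ᶠ[𝓝 0]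
      fun t => 2 * fderiv ℝ e (p + t • Y) X := by
    have hc : ContinuousAt (fun t : ℝ => p + t • Y) 0 := (hline p Y).continuousAt
    filter_upwards [hc.eventually (hO.mem_nhds (by simpa using hp))] with t ht
    have hd : HasFDerivAt e (fderiv ℝ e (p + t • Y)) (p + t • Y + (0 : ℝ) • X) := by
      rw [zero_smul, add_zero]
      exact ((hcd _ ht).differentiableAt (by simp)).hasFDerivAt
    exact ((hd.comp_hasDerivAt (0 : ℝ) (hline (p + t • Y) X)).const_mul 2).deriv
  have hd : HasFDerivAt (fderiv ℝ e) (fderiv ℝ (fderiv ℝ e) p) p :=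
    (((hcd _ hp).fderiv_right (m := 1) (by norm_cast)).differentiableAt (by simp)).hasFDerivAt
  have hd2 : HasFDerivAt (fun q => fderiv ℝ e q X) ((fderiv ℝ (fderiv ℝ e) p).flip X) p := by
    simpa using hd.clm_apply (hasFDerivAt_const X p)
  have hd3 : HasDerivAt (fun t : ℝ => fderiv ℝ e (p + t • Y) X)
      (fderiv ℝ (fderiv ℝ e) p Y X) 0 :=
    HasFDerivAt.comp_hasDerivAt (l := fun q => fderiv ℝ e q X)
      (l' := (fderiv ℝ (fderiv ℝ e) p).flip X) (f := fun t : ℝ => p + t • Y) (0 : ℝ)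
      (by simpa using hd2) (hline p Y)
  rw [h2.deriv_eq]
  exact (hd3.const_mul 2).deriv

/-! ### The Finsler metric, its symplectic form and its spray in tangent charts -/

section FinslerCharts

variable {E : Type*} [NormedAddCommGroup E] [NormedSpace ℝ E]
  {M : Type*} [TopologicalSpace M] [ChartedSpace E M] [IsManifold 𝓘(ℝ, E) ∞ M]

/-- The part of the range of a tangent chart that corresponds to nonzero vectors. -/
def slitRange (w₀ : TM E M) : Set (E × E) :=
  (extChartAt 𝓘(ℝ, E) w₀.proj).target ×ˢ {0}ᶜ

theorem mem_slitRange_iff {w₀ z : TM E M}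
    (hz : z.proj ∈ (extChartAt 𝓘(ℝ, E) w₀.proj).source) :
    extChartAt 𝓘(ℝ, E).tangent w₀ z ∈ slitRange w₀ ↔ z ∈ slit E M := by
  rw [mem_slit_iff hz]
  refine ⟨fun h => h.2, fun h => ⟨?_, h⟩⟩
  rw [tangent_extChartAt_apply hz]
  exact (extChartAt 𝓘(ℝ, E) w₀.proj).map_source hz

theorem slitRange_subset_target (w₀ : TM E M) :
    slitRange w₀ ⊆ (extChartAt 𝓘(ℝ, E).tangent w₀).target := by
  rw [tangent_extChartAt_target]
  exact fun p hp => ⟨hp.1, trivial⟩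

theorem exists_of_mem_slitRange {w₀ : TM E M} {p : E × E} (hp : p ∈ slitRange w₀) :
    ∃ z : TM E M, z.proj ∈ (extChartAt 𝓘(ℝ, E) w₀.proj).source ∧ z ∈ slit E M ∧
      extChartAt 𝓘(ℝ, E).tangent w₀ z = p := by
  have ht := slitRange_subset_target w₀ hp
  have hs := mem_tangent_extChartAt_source.1 ((extChartAt 𝓘(ℝ, E).tangent w₀).map_target ht)
  have hr := (extChartAt 𝓘(ℝ, E).tangent w₀).right_inv ht
  exact ⟨_, hs, (mem_slitRange_iff hs).1 (by rwa [hr]), hr⟩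

theorem isOpen_slit_of_chart {w₀ z : TM E M}
    (hz : z.proj ∈ (extChartAt 𝓘(ℝ, E) w₀.proj).source) (hs : z ∈ slit E M) :
    ∀ᶠ y in 𝓝 z, y.proj ∈ (extChartAt 𝓘(ℝ, E) w₀.proj).source ∧ y ∈ slit E M := by
  have hz' := mem_tangent_extChartAt_source.2 hz
  have hc : ContinuousAt (extChartAt 𝓘(ℝ, E).tangent w₀) z := continuousAt_extChartAt' hz'
  have h1 : ∀ᶠ y in 𝓝 z, (extChartAt 𝓘(ℝ, E).tangent w₀ y).2 ≠ 0 :=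
    (continuous_snd.continuousAt.comp hc).eventually
      (isOpen_compl_singleton.mem_nhds ((mem_slit_iff hz).1 hs))
  filter_upwards [eventually_mem_extChartAt_source hz', h1] with y hy1 hy2
  have hy := mem_tangent_extChartAt_source.1 hy1
  exact ⟨hy, (mem_slit_iff hy).2 hy2⟩

theorem isOpen_slit : IsOpen (slit E M) := by
  rw [isOpen_iff_mem_nhds]
  intro z hz
  filter_upwards [isOpen_slit_of_chart (mem_extChartAt_source z.proj) hz] with y hy using hy.2

namespace FinslerMetric

variable (F : FinslerMetric E M)

/-- The energy of `F` read in a tangent chart. -/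
def energyRep (w₀ : TM E M) : E × E → ℝ := F.energy ∘ (extChartAt 𝓘(ℝ, E).tangent w₀).symm

theorem energyRep_apply {w₀ z : TM E M}
    (hz : z.proj ∈ (extChartAt 𝓘(ℝ, E) w₀.proj).source) :
    F.energyRep w₀ (extChartAt 𝓘(ℝ, E).tangent w₀ z) = F.energy z := by
  rw [energyRep, Function.comp_apply,
    (extChartAt 𝓘(ℝ, E).tangent w₀).left_inv (mem_tangent_extChartAt_source.2 hz)]

theorem energyRep_apply_add {w₀ z : TM E M}
    (hz : z.proj ∈ (extChartAt 𝓘(ℝ, E) w₀.proj).source) (u : TangentSpace 𝓘(ℝ, E) z.proj) :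
    F.energyRep w₀ (extChartAt 𝓘(ℝ, E).tangent w₀ z +
      (0, chartDeriv 𝓘(ℝ, E) w₀.proj z.proj u)) = F.energy ⟨z.proj, z.2 + u⟩ := by
  rw [← F.energyRep_apply (w₀ := w₀) (z := ⟨z.proj, z.2 + u⟩) hz, tangent_extChartAt_apply hz,
    tangent_extChartAt_apply (z := ⟨z.proj, z.2 + u⟩) hz]
  simp

theorem contDiffOn_energyRep (w₀ : TM E M) :
    ContDiffOn ℝ ∞ (F.energyRep w₀) (slitRange w₀) := by
  have h1 : ContMDiffOn 𝓘(ℝ, E).tangent 𝓘(ℝ, ℝ) ∞ F.energy (slit E M) :=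
    contMDiffOn_const.mul (F.smooth.pow 2)
  have h2 := h1.comp ((contMDiffOn_extChartAt_symm (I := 𝓘(ℝ, E).tangent) (n := ∞) w₀).mono
    (slitRange_subset_target w₀)) (by
      intro p hp
      obtain ⟨z, hz, hs, rfl⟩ := exists_of_mem_slitRange hp
      rw [mem_preimage,
        (extChartAt 𝓘(ℝ, E).tangent w₀).left_inv (mem_tangent_extChartAt_source.2 hz)]
      exact hs)
  exact h2.contDiffOn

omit [IsManifold 𝓘(ℝ, E) ∞ M] in
theorem isOpen_slitRange (w₀ : TM E M) : IsOpen (slitRange w₀) :=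
  (isOpen_extChartAt_target w₀.proj).prod isOpen_compl_singleton

/-- Tangent charts are linear on fibres, so the plane spanned by u and v in the fibre goes to an
affine plane, on which F² = 2e. The factors 2 and 1/2 cancel. -/
theorem fiberHessian_eq {w₀ z : TM E M}
    (hz : z.proj ∈ (extChartAt 𝓘(ℝ, E) w₀.proj).source) (hs : z ∈ slit E M)
    (u v : TangentSpace 𝓘(ℝ, E) z.proj) :
    fiberHessian F.F z u v =
      fderiv ℝ (fderiv ℝ (F.energyRep w₀)) (extChartAt 𝓘(ℝ, E).tangent w₀ z)
        (0, chartDeriv 𝓘(ℝ, E) w₀.proj z.proj v) (0, chartDeriv 𝓘(ℝ, E) w₀.proj z.proj u) := by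
  set p := extChartAt 𝓘(ℝ, E).tangent w₀ z with hp
  set e := F.energyRep w₀ with he
  set B := chartDeriv 𝓘(ℝ, E) w₀.proj z.proj with hB
  have hpΩ : p ∈ slitRange w₀ := (mem_slitRange_iff hz).2 hs
  have hO := isOpen_slitRange w₀
  have h1 : ∀ s t : ℝ, F.F ⟨z.proj, z.2 + s • u + t • v⟩ ^ 2 =
      2 * e (p + t • (0, B v) + s • (0, B u)) := by
    intro s t
    have h2 : e (p + (0, B (s • u + t • v))) = F.energy ⟨z.proj, z.2 + (s • u + t • v)⟩ :=
      F.energyRep_apply_add hz (s • u + t • v)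
    rw [energy] at h2
    have h3 : p + t • ((0, B v) : E × E) + s • (0, B u) = p + (0, B (s • u + t • v)) := by
      rw [map_add, map_smul, map_smul]
      ext1
      · simp
      · simp only [Prod.snd_add, Prod.smul_snd]; abel
    rw [h3, add_assoc]
    linarith
  rw [fiberHessian]
  simp only [h1]
  rw [deriv_deriv_line hO (F.contDiffOn_energyRep w₀) hpΩ]
  ring

theorem isEnergyOn (w₀ : TM E M) : IsEnergyOn (F.energyRep w₀) (slitRange w₀) where
  isOpen := isOpen_slitRange w₀
  contDiffOn := F.contDiffOn_energyRep w₀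
  euler := by
    intro p hp
    have hd : HasFDerivAt (F.energyRep w₀) (fderiv ℝ (F.energyRep w₀) p) p :=
      (((F.contDiffOn_energyRep w₀).contDiffAt
        ((isOpen_slitRange w₀).mem_nhds hp)).differentiableAt (by simp)).hasFDerivAt
    obtain ⟨z, hz, hs, rfl⟩ := exists_of_mem_slitRange hp
    set p := extChartAt 𝓘(ℝ, E).tangent w₀ z with hpdef
    have h2 : HasDerivAt (fun t : ℝ => p + t • ((0, p.2) : E × E)) (0, p.2) 0 := by
      simpa using ((hasDerivAt_id (0 : ℝ)).smul_const ((0, p.2) : E × E)).const_add p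
    have h3 := HasFDerivAt.comp_hasDerivAt (f := fun t : ℝ => p + t • ((0, p.2) : E × E))
      (0 : ℝ) (by simpa using hd) h2
    have h4 : F.energyRep w₀ ∘ (fun t : ℝ => p + t • ((0, p.2) : E × E)) =ᶠ[𝓝 0]
        fun t => (1 + t) ^ 2 * F.energyRep w₀ p := by
      -- Homogeneity is only for positive factors, and 1 + t > 0 near t = 0.
      filter_upwards [lt_mem_nhds (show (-1 : ℝ) < 0 by norm_num)] with t ht
      have h5 := F.energyRep_apply_add hz (t • z.2)
      have h6 : p.2 = chartDeriv 𝓘(ℝ, E) w₀.proj z.proj z.2 := by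
        rw [hpdef, tangent_extChartAt_apply hz]
      have h7 : z.2 + t • z.2 = (1 + t) • z.2 := by rw [add_smul, one_smul]
      rw [map_smul, ← h6, h7, energy, F.homogeneous z.proj z.2 (1 + t) (by linarith)] at h5
      rw [Function.comp_apply, F.energyRep_apply hz, energy]
      have h8 : t • ((0, p.2) : E × E) = (0, t • p.2) := by simp
      rw [h8, h5]
      ring
    have h9 : HasDerivAt (fun t : ℝ => (1 + t) ^ 2 * F.energyRep w₀ p)
        (2 * F.energyRep w₀ p) 0 := by
      have := (((hasDerivAt_id (0 : ℝ)).const_add 1).pow 2).mul_const (F.energyRep w₀ p)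
      simpa using this
    exact (h3.congr_of_eventuallyEq h4.symm).unique h9
  pos := by
    intro p hp a ha
    obtain ⟨z, hz, hs, rfl⟩ := exists_of_mem_slitRange hp
    obtain ⟨u, rfl⟩ := chartDeriv_surjective hz a
    have h := F.posDef z hs u (by rintro rfl; simp at ha)
    rwa [F.fiberHessian_eq hz hs] at h

theorem g_eq {w₀ z : TM E M}
    (hz : z.proj ∈ (extChartAt 𝓘(ℝ, E) w₀.proj).source) (hs : z ∈ slit E M)
    (u v : TangentSpace 𝓘(ℝ, E) z.proj) :
    F.g z u v = fderiv ℝ (fderiv ℝ (F.energyRep w₀)) (extChartAt 𝓘(ℝ, E).tangent w₀ z)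
      (0, chartDeriv 𝓘(ℝ, E) w₀.proj z.proj u) (0, chartDeriv 𝓘(ℝ, E) w₀.proj z.proj v) := by
  rw [g, F.fiberHessian_eq hz hs, (F.isEnergyOn w₀).symm ((mem_slitRange_iff hz).2 hs)]

theorem g_self_left_eq {w₀ z : TM E M}
    (hz : z.proj ∈ (extChartAt 𝓘(ℝ, E) w₀.proj).source) (hs : z ∈ slit E M)
    (v : TangentSpace 𝓘(ℝ, E) z.proj) :
    F.g z z.2 v = fderiv ℝ (F.energyRep w₀) (extChartAt 𝓘(ℝ, E).tangent w₀ z)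
      (0, chartDeriv 𝓘(ℝ, E) w₀.proj z.proj v) := by
  have hp := (mem_slitRange_iff hz).2 hs
  have h2 : chartDeriv 𝓘(ℝ, E) w₀.proj z.proj z.2 = (extChartAt 𝓘(ℝ, E).tangent w₀ z).2 := by
    rw [tangent_extChartAt_apply hz]
  rw [F.g_eq hz hs, (F.isEnergyOn w₀).symm hp, h2, (F.isEnergyOn w₀).vertical_euler hp]

theorem omega_eq {w₀ z : TM E M}
    (hz : z.proj ∈ (extChartAt 𝓘(ℝ, E) w₀.proj).source) (hs : z ∈ slit E M) (X Y : TTM z) :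
    F.omega z X Y =
      fderiv ℝ (fderiv ℝ (F.energyRep w₀)) (extChartAt 𝓘(ℝ, E).tangent w₀ z)
        (chartDeriv 𝓘(ℝ, E).tangent w₀ z Y) (0, (chartDeriv 𝓘(ℝ, E).tangent w₀ z X).1)
      - fderiv ℝ (fderiv ℝ (F.energyRep w₀)) (extChartAt 𝓘(ℝ, E).tangent w₀ z)
        (chartDeriv 𝓘(ℝ, E).tangent w₀ z X) (0, (chartDeriv 𝓘(ℝ, E).tangent w₀ z Y).1) := by
  have hp := (mem_slitRange_iff hz).2 hs
  set J : E × E →L[ℝ] E × E :=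
    (ContinuousLinearMap.inr ℝ E E) ∘L (ContinuousLinearMap.fst ℝ E E) with hJ
  set Θ : E × E → E × E →L[ℝ] ℝ := fun p => (fderiv ℝ (F.energyRep w₀) p) ∘L J with hΘ
  have hd := ((F.isEnergyOn w₀).hasFDerivAt_fderiv hp).clm_comp (hasFDerivAt_const J _)
  have h : ∀ᶠ y in 𝓝 z, ∀ X : TTM y, F.hilbertForm y X =
      Θ (extChartAt 𝓘(ℝ, E).tangent w₀ y) (chartDeriv 𝓘(ℝ, E).tangent w₀ y X) := by
    filter_upwards [isOpen_slit_of_chart hz hs] with y hy X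
    rw [hilbertForm, F.g_self_left_eq hy.1 hy.2, chartDeriv_dpi hy.1]
    rfl
  have h2 := extDerivOneForm_eq_of_rep (mem_tangent_extChartAt_source.2 hz)
    hd.differentiableAt h X Y
  rw [omega, h2, hd.fderiv]
  simp [J]

theorem mvfderiv_energy {w₀ z : TM E M}
    (hz : z.proj ∈ (extChartAt 𝓘(ℝ, E) w₀.proj).source) (hs : z ∈ slit E M) (X : TTM z) :
    mvfderiv 𝓘(ℝ, E).tangent F.energy z X =
      fderiv ℝ (F.energyRep w₀) (extChartAt 𝓘(ℝ, E).tangent w₀ z)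
        (chartDeriv 𝓘(ℝ, E).tangent w₀ z X) :=
  mvfderiv_eq_fderiv_rep (mem_tangent_extChartAt_source.2 hz)
    ((F.isEnergyOn w₀).hasFDerivAt ((mem_slitRange_iff hz).2 hs)).differentiableAt X

/-- The spray is defined by choice; existence of a solution makes the choice meaningful and
`spray_unique` identifies it. -/
theorem chartDeriv_spray [FiniteDimensional ℝ E] {w₀ z : TM E M}
    (hz : z.proj ∈ (extChartAt 𝓘(ℝ, E) w₀.proj).source) (hs : z ∈ slit E M) :
    chartDeriv 𝓘(ℝ, E).tangent w₀ z (F.spray z) =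
      ((extChartAt 𝓘(ℝ, E).tangent w₀ z).2,
        sprayVec (F.energyRep w₀) (extChartAt 𝓘(ℝ, E).tangent w₀ z)) := by
  have hp := (mem_slitRange_iff hz).2 hs
  have hz' := mem_tangent_extChartAt_source.2 hz
  have key : ∀ X : TTM z,
      (∀ Y : TTM z, mvfderiv 𝓘(ℝ, E).tangent F.energy z Y = F.omega z X Y) ↔
      chartDeriv 𝓘(ℝ, E).tangent w₀ z X = ((extChartAt 𝓘(ℝ, E).tangent w₀ z).2,
        sprayVec (F.energyRep w₀) (extChartAt 𝓘(ℝ, E).tangent w₀ z)) := by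
    intro X
    rw [← (F.isEnergyOn w₀).spray_unique hp]
    simp only [F.mvfderiv_energy hz hs, F.omega_eq hz hs]
    constructor
    · intro h Y
      obtain ⟨Y, rfl⟩ := chartDeriv_surjective hz' Y
      exact h Y
    · intro h Y
      exact h _
  rw [← key]
  obtain ⟨X, hX⟩ := chartDeriv_surjective hz' ((extChartAt 𝓘(ℝ, E).tangent w₀ z).2,
        sprayVec (F.energyRep w₀) (extChartAt 𝓘(ℝ, E).tangent w₀ z))
  exact Classical.epsilon_spec
    (p := fun X : TTM z => ∀ Y : TTM z, mvfderiv 𝓘(ℝ, E).tangent F.energy z Y = F.omega z X Y)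
    ⟨X, (key X).2 hX⟩

end FinslerMetric

end FinslerCharts

/-! ### The canonical connection of the spray in coordinates -/

section CanonicalConnection

variable {E : Type*} [NormedAddCommGroup E] [NormedSpace ℝ E] [FiniteDimensional ℝ E]
  {M : Type*} [TopologicalSpace M] [ChartedSpace E M] [IsManifold 𝓘(ℝ, E) ∞ M]

namespace FinslerMetric

variable (F : FinslerMetric E M)

theorem fieldRep_spray_eventuallyEq {w : TM E M} (hw : w ∈ slit E M) :
    fieldRep 𝓘(ℝ, E).tangent w F.spray =ᶠ[𝓝 (extChartAt 𝓘(ℝ, E).tangent w w)]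
      fun q => (q.2, sprayVec (F.energyRep w) q) := by
  have hs := mem_extChartAt_source (I := 𝓘(ℝ, E).tangent) w
  filter_upwards [extChartAt_target_mem_nhds (I := 𝓘(ℝ, E).tangent) w,
    extChartAt_symm_mem_of_eventually hs
      (isOpen_slit_of_chart (mem_extChartAt_source w.proj) hw)] with q hq hq2
  rw [fieldRep, F.chartDeriv_spray hq2.1 hq2.2, (extChartAt 𝓘(ℝ, E).tangent w).right_inv hq]

omit [FiniteDimensional ℝ E] in
theorem fieldRep_almostTangent_localExtension_eventuallyEq {w : TM E M} (X : TTM w) :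
    fieldRep 𝓘(ℝ, E).tangent w
        (fun z => almostTangent z (localExtension 𝓘(ℝ, E).tangent X z))
      =ᶠ[𝓝 (extChartAt 𝓘(ℝ, E).tangent w w)]
      fun _ => (0, (chartDeriv 𝓘(ℝ, E).tangent w w X).1) := by
  filter_upwards [extChartAt_target_mem_nhds (I := 𝓘(ℝ, E).tangent) w] with q hq
  have hq' := (extChartAt 𝓘(ℝ, E).tangent w).map_target hq
  rw [fieldRep, chartDeriv_almostTangent (mem_tangent_extChartAt_source.1 hq'),
    chartDeriv_localExtension hq']

theorem lieBracket_sprayRep_const {w : TM E M} (hw : w ∈ slit E M) (c : E × E) :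
    lieBracket ℝ (fun q : E × E => ((q.2, sprayVec (F.energyRep w) q) : E × E)) (fun _ => c)
      (extChartAt 𝓘(ℝ, E).tangent w w) =
      (-c.2, -fderiv ℝ (sprayVec (F.energyRep w)) (extChartAt 𝓘(ℝ, E).tangent w w) c) := by
  have hp := (mem_slitRange_iff (mem_extChartAt_source w.proj)).2 hw
  have hd := (hasFDerivAt_snd (𝕜 := ℝ) (p := extChartAt 𝓘(ℝ, E).tangent w w)).prodMk
    ((F.isEnergyOn w).differentiableAt_sprayVec hp).hasFDerivAt
  simp only [lieBracket_eq, hd.fderiv]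
  simp

/-- Both the local extension of X and its image under the almost-tangent structure have constant
components, so the two brackets only differentiate the spray. The derivatives combine to Γ(a, b) =
(a, −2Na − b). -/
theorem chartDeriv_grifoneConnection {w : TM E M} (hw : w ∈ slit E M) (X : TTM w) :
    chartDeriv 𝓘(ℝ, E).tangent w w (grifoneConnection F.spray w X) =
      ((chartDeriv 𝓘(ℝ, E).tangent w w X).1,
        -(2 : ℝ) • nonlinConn (F.energyRep w) (extChartAt 𝓘(ℝ, E).tangent w w)
          (chartDeriv 𝓘(ℝ, E).tangent w w X).1 - (chartDeriv 𝓘(ℝ, E).tangent w w X).2) := by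
  have hs := mem_extChartAt_source (I := 𝓘(ℝ, E)) w.proj
  have h1 := (F.fieldRep_spray_eventuallyEq hw).lieBracket_vectorField_eq (𝕜 := ℝ)
    (fieldRep_almostTangent_localExtension_eventuallyEq X)
  have h2 := (F.fieldRep_spray_eventuallyEq hw).lieBracket_vectorField_eq (𝕜 := ℝ)
    (fieldRep_localExtension_eventuallyEq X)
  rw [grifoneConnection, map_neg, map_sub, chartDeriv_almostTangent hs, chartDeriv_mlieBracket,
    chartDeriv_mlieBracket, h1, h2, F.lieBracket_sprayRep_const hw,
    F.lieBracket_sprayRep_const hw, nonlinConn, smul_smul]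
  norm_num
  abel

theorem chartDeriv_verticalProj {w : TM E M} (hw : w ∈ slit E M) (X : TTM w) :
    chartDeriv 𝓘(ℝ, E).tangent w w (verticalProj F.spray w X) =
      (0, (chartDeriv 𝓘(ℝ, E).tangent w w X).2 +
        nonlinConn (F.energyRep w) (extChartAt 𝓘(ℝ, E).tangent w w)
          (chartDeriv 𝓘(ℝ, E).tangent w w X).1) := by
  rw [verticalProj, map_smul, map_sub, F.chartDeriv_grifoneConnection hw]
  ext1
  · simp
  · simp only [Prod.smul_snd, Prod.snd_sub]
    module

theorem chartDeriv_vliftInv_verticalProj {w : TM E M} (hw : w ∈ slit E M) (X : TTM w) :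
    chartDeriv 𝓘(ℝ, E) w.proj w.proj (vliftInv w (verticalProj F.spray w X)) =
      (chartDeriv 𝓘(ℝ, E).tangent w w X).2 +
        nonlinConn (F.energyRep w) (extChartAt 𝓘(ℝ, E).tangent w w)
          (chartDeriv 𝓘(ℝ, E).tangent w w X).1 := by
  rw [chartDeriv_vliftInv (mem_extChartAt_source w.proj)] <;> rw [F.chartDeriv_verticalProj hw]

/-- The conditions Γ(X) = X and dπ(X) = u read X = (u, −Nu) in coordinates. This has exactly one
solution, so the choice in `hlift` returns it. -/
theorem chartDeriv_hlift {w : TM E M} (hw : w ∈ slit E M)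
    (u : TangentSpace 𝓘(ℝ, E) w.proj) :
    chartDeriv 𝓘(ℝ, E).tangent w w (hlift F.spray w u) =
      (chartDeriv 𝓘(ℝ, E) w.proj w.proj u,
        -nonlinConn (F.energyRep w) (extChartAt 𝓘(ℝ, E).tangent w w)
          (chartDeriv 𝓘(ℝ, E) w.proj w.proj u)) := by
  have hs := mem_extChartAt_source (I := 𝓘(ℝ, E)) w.proj
  have hs' := mem_extChartAt_source (I := 𝓘(ℝ, E).tangent) w
  set N := nonlinConn (F.energyRep w) (extChartAt 𝓘(ℝ, E).tangent w w) with hN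
  set A := chartDeriv 𝓘(ℝ, E).tangent w w with hA
  set B := chartDeriv 𝓘(ℝ, E) w.proj w.proj with hB
  have key : ∀ X : TTM w, (grifoneConnection F.spray w X = X ∧ dpi w X = u) ↔
      A X = (B u, -N (B u)) := by
    intro X
    rw [← (chartDeriv_injective hs').eq_iff, ← (chartDeriv_injective hs).eq_iff (b := u),
      F.chartDeriv_grifoneConnection hw, chartDeriv_dpi hs, ← hA, ← hB, ← hN, Prod.ext_iff,
      Prod.ext_iff]
    simp only [true_and]
    rw [and_comm]
    refine and_congr_right fun h => ?_
    rw [h]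
    constructor
    · intro h2
      have h3 : (2 : ℝ) • (A X).2 = (2 : ℝ) • (-N (B u)) := by
        rw [two_smul]
        nth_rewrite 1 [← h2]
        module
      exact smul_right_injective E (two_ne_zero' ℝ) h3
    · intro h2
      rw [h2]
      module
  rw [← key]
  obtain ⟨X, hX⟩ := chartDeriv_surjective hs' (B u, -N (B u))
  exact Classical.epsilon_spec
    (p := fun X : TTM w => grifoneConnection F.spray w X = X ∧ dpi w X = u)
    ⟨X, (key X).2 hX⟩

end FinslerMetric

end CanonicalConnection

/-! ### The map that flattens the conormal bundle -/

section SliceMap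

variable {V : Type*} [NormedAddCommGroup V] [NormedSpace ℝ V]

theorem isInvertible_of_injective [FiniteDimensional ℝ V] {T : V →L[ℝ] V}
    (hT : Function.Injective T) : T.IsInvertible :=
  ⟨(LinearEquiv.ofInjectiveEndo (T : V →ₗ[ℝ] V) hT).toContinuousLinearEquiv, by ext; rfl⟩

theorem nonempty_dual_equiv [FiniteDimensional ℝ V] : Nonempty ((V →L[ℝ] ℝ) ≃L[ℝ] V) := by
  have hfd : Module.finrank ℝ (V →L[ℝ] ℝ) = Module.finrank ℝ V := by
    rw [← (LinearMap.toContinuousLinearMap (𝕜 := ℝ) (E := V) (F' := ℝ)).finrank_eq]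
    exact Subspace.dual_finrank_eq (K := ℝ) (V := V)
  exact ⟨ContinuousLinearEquiv.ofFinrankEq hfd⟩

/-- The Legendre transform of the energy `e`, read in the coordinates changed by `ψ`. -/
def legendreRep (e : V × V → ℝ) (ψ : V → V) (p : V × V) : V →L[ℝ] ℝ :=
  ((fderiv ℝ e p) ∘L (ContinuousLinearMap.inr ℝ V V)) ∘L (fderiv ℝ ψ p.1).inverse

/-- The coordinates on `V × V` given by `ψ` and the Legendre transform of `e`. -/
def cotangentCoord (j : (V →L[ℝ] ℝ) ≃L[ℝ] V) (e : V × V → ℝ) (ψ : V → V) (p : V × V) : V × V :=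
  (ψ p.1, j (legendreRep e ψ p))

/-- The conormal space of the subspace `L`, identified with a subspace of `V × V` by `j`. -/
def conormalSubmodule (j : (V →L[ℝ] ℝ) ≃L[ℝ] V) (L : Submodule ℝ V) : Submodule ℝ (V × V) where
  carrier := {c | c.1 ∈ L ∧ ∀ l ∈ L, j.symm c.2 l = 0}
  add_mem' := by
    rintro a b ⟨ha, ha'⟩ ⟨hb, hb'⟩
    exact ⟨L.add_mem ha hb, fun l hl => by simp [ha' l hl, hb' l hl]⟩
  zero_mem' := ⟨L.zero_mem, fun l _ => by simp⟩
  smul_mem' := by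
    rintro c a ⟨ha, ha'⟩
    exact ⟨L.smul_mem c ha, fun l hl => by simp [ha' l hl]⟩

theorem mem_conormalSubmodule {j : (V →L[ℝ] ℝ) ≃L[ℝ] V} {L : Submodule ℝ V} {c : V × V} :
    c ∈ conormalSubmodule j L ↔ c.1 ∈ L ∧ ∀ l ∈ L, j.symm c.2 l = 0 := Iff.rfl

variable {e : V × V → ℝ} {Ω : Set (V × V)} (h : IsEnergyOn e Ω) {ψ : V → V} {U : Set V}

theorem legendreRep_apply {p : V × V} (hinv : (fderiv ℝ ψ p.1).IsInvertible) (u : V) :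
    legendreRep e ψ p (fderiv ℝ ψ p.1 u) = fderiv ℝ e p (0, u) := by
  simp [legendreRep, hinv.inverse_apply_self]

include h

theorem contDiffAt_legendreRep [CompleteSpace V] (hU : IsOpen U) (hψ : ContDiffOn ℝ ∞ ψ U)
    {p : V × V} (hp : p ∈ Ω) (hpU : p.1 ∈ U) (hinv : (fderiv ℝ ψ p.1).IsInvertible) :
    ContDiffAt ℝ ∞ (legendreRep e ψ) p := by
  have h1 : ContDiffAt ℝ ∞ (fderiv ℝ ψ) p.1 :=
    (hψ.contDiffAt (hU.mem_nhds hpU)).fderiv_right (by simp)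
  have h2 : ContDiffAt ℝ ∞ (fun q : V × V => fderiv ℝ ψ q.1) p := h1.comp p contDiffAt_fst
  obtain ⟨A, hA⟩ := hinv
  have h3 : ContDiffAt ℝ ∞ ContinuousLinearMap.inverse (fderiv ℝ ψ p.1) := by
    rw [← hA]; exact contDiffAt_map_inverse A
  have h4 := ContDiffAt.comp (g := ContinuousLinearMap.inverse)
    (f := fun q : V × V => fderiv ℝ ψ q.1) p h3 h2
  have h5 := ((h.contDiffAt_fderiv hp).clm_comp
    (contDiffAt_const (c := ContinuousLinearMap.inr ℝ V V))).clm_comp h4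
  exact h5

/-- Differentiating the identity λ(Dψ·u) = ∂_y e(u) of `legendreRep_apply` avoids differentiating
the inverse of Dψ; the product rule produces the D²ψ correction. -/
theorem fderiv_legendreRep [CompleteSpace V] (hU : IsOpen U) (hψ : ContDiffOn ℝ ∞ ψ U)
    (hinv : ∀ q ∈ U, (fderiv ℝ ψ q).IsInvertible)
    {p : V × V} (hp : p ∈ Ω) (hpU : p.1 ∈ U) (X : V × V) (u : V) :
    fderiv ℝ (legendreRep e ψ) p X (fderiv ℝ ψ p.1 u) =
      fderiv ℝ (fderiv ℝ e) p X (0, u)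
        - legendreRep e ψ p (fderiv ℝ (fderiv ℝ ψ) p.1 X.1 u) := by
  have h1 : HasFDerivAt (fderiv ℝ ψ) (fderiv ℝ (fderiv ℝ ψ) p.1) p.1 :=
    (((hψ.contDiffAt (hU.mem_nhds hpU)).fderiv_right (m := 1)
      (by norm_cast)).differentiableAt (by simp)).hasFDerivAt
  have h2 : HasFDerivAt (fun q : V × V => fderiv ℝ ψ q.1 u) _ p :=
    (HasFDerivAt.comp p h1 hasFDerivAt_fst).clm_apply (hasFDerivAt_const u p)
  have h3 := ((contDiffAt_legendreRep h hU hψ hp hpU (hinv _ hpU)).differentiableAt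
    (by simp)).hasFDerivAt.clm_apply h2
  have h4 := (h.hasFDerivAt_fderiv hp).clm_apply (hasFDerivAt_const ((0, u) : V × V) p)
  have h5 : (fun q : V × V => legendreRep e ψ q (fderiv ℝ ψ q.1 u)) =ᶠ[𝓝 p]
      fun q => fderiv ℝ e q (0, u) := by
    filter_upwards [continuous_fst.continuousAt.eventually (hU.mem_nhds hpU)] with q hq
    exact legendreRep_apply (hinv _ hq) u
  have h6 := congrArg (fun L => L X) ((h3.congr_of_eventuallyEq h5.symm).unique h4)
  simp at h6
  linarith

theorem contDiffOn_cotangentCoord [CompleteSpace V] (j : (V →L[ℝ] ℝ) ≃L[ℝ] V) (hU : IsOpen U)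
    (hψ : ContDiffOn ℝ ∞ ψ U) (hinv : ∀ q ∈ U, (fderiv ℝ ψ q).IsInvertible) :
    ContDiffOn ℝ ∞ (cotangentCoord j e ψ) (Ω ∩ Prod.fst ⁻¹' U) := by
  intro p hp
  have h1 : ContDiffAt ℝ ∞ (fun q : V × V => ψ q.1) p :=
    (hψ.contDiffAt (hU.mem_nhds hp.2)).comp p contDiffAt_fst
  have h2 := contDiffAt_legendreRep h hU hψ hp.1 hp.2 (hinv _ hp.2)
  exact (h1.prodMk (j.contDiff.contDiffAt.comp p h2)).contDiffWithinAt

theorem fderiv_cotangentCoord [CompleteSpace V] (j : (V →L[ℝ] ℝ) ≃L[ℝ] V) (hU : IsOpen U)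
    (hψ : ContDiffOn ℝ ∞ ψ U) (hinv : ∀ q ∈ U, (fderiv ℝ ψ q).IsInvertible)
    {p : V × V} (hp : p ∈ Ω) (hpU : p.1 ∈ U) (X : V × V) :
    fderiv ℝ (cotangentCoord j e ψ) p X =
      (fderiv ℝ ψ p.1 X.1, j (fderiv ℝ (legendreRep e ψ) p X)) := by
  have h1 : HasFDerivAt (fun q : V × V => ψ q.1) _ p :=
    HasFDerivAt.comp p ((hψ.contDiffAt (hU.mem_nhds hpU)).differentiableAt
      (by simp)).hasFDerivAt hasFDerivAt_fst
  have h2 := ((contDiffAt_legendreRep h hU hψ hp hpU (hinv _ hpU)).differentiableAt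
    (by simp)).hasFDerivAt
  have h3 := h1.prodMk (HasFDerivAt.comp p j.hasFDerivAt h2)
  have h4 : fderiv ℝ (cotangentCoord j e ψ) p = _ := HasFDerivAt.fderiv h3
  rw [h4]
  rfl

/-- The derivative is block triangular, with diagonal blocks given by Dψ and, up to isomorphisms,
the vertical Hessian. Both are injective. -/
theorem isInvertible_fderiv_cotangentCoord [FiniteDimensional ℝ V] (j : (V →L[ℝ] ℝ) ≃L[ℝ] V)
    (hU : IsOpen U) (hψ : ContDiffOn ℝ ∞ ψ U) (hinv : ∀ q ∈ U, (fderiv ℝ ψ q).IsInvertible)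
    {p : V × V} (hp : p ∈ Ω) (hpU : p.1 ∈ U) :
    (fderiv ℝ (cotangentCoord j e ψ) p).IsInvertible := by
  have := FiniteDimensional.complete ℝ V
  apply isInvertible_of_injective
  rw [injective_iff_map_eq_zero]
  rintro ⟨a, b⟩ hX
  rw [fderiv_cotangentCoord h j hU hψ hinv hp hpU, Prod.mk_eq_zero, map_eq_zero_iff _ j.injective]
    at hX
  obtain ⟨A, hA⟩ := hinv _ hpU
  have ha : a = 0 := by
    have h1 := hX.1
    rw [← hA] at h1
    simpa using h1
  subst ha
  have hb : b = 0 := h.eq_zero_of_forall hp fun c => by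
    have h2 := fderiv_legendreRep h hU hψ hinv hp hpU (0, b) c
    rw [hX.2] at h2
    simp only [map_zero, zero_apply, sub_zero] at h2
    exact h2.symm
  rw [hb, Prod.mk_zero_zero]

omit h in
theorem forall_legendreRep_eq_zero_iff {p : V × V} (hinv : (fderiv ℝ ψ p.1).IsInvertible)
    (L : Submodule ℝ V) :
    (∀ l ∈ L, legendreRep e ψ p l = 0) ↔
      ∀ u, fderiv ℝ ψ p.1 u ∈ L → fderiv ℝ e p (0, u) = 0 := by
  constructor
  · intro h1 u hu
    rw [← legendreRep_apply hinv, h1 _ hu]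
  · intro h1 l hl
    obtain ⟨A, hA⟩ := hinv
    have h2 : fderiv ℝ ψ p.1 (A.symm l) = l := by rw [← hA]; simp
    rw [← h2, legendreRep_apply ⟨A, hA⟩]
    exact h1 _ (by rwa [h2])

theorem fderiv_cotangentCoord_mem_iff [CompleteSpace V] (j : (V →L[ℝ] ℝ) ≃L[ℝ] V) (hU : IsOpen U)
    (hψ : ContDiffOn ℝ ∞ ψ U) (hinv : ∀ q ∈ U, (fderiv ℝ ψ q).IsInvertible)
    {p : V × V} (hp : p ∈ Ω) (hpU : p.1 ∈ U) (L : Submodule ℝ V) (X : V × V) :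
    fderiv ℝ (cotangentCoord j e ψ) p X ∈ conormalSubmodule j L ↔
      fderiv ℝ ψ p.1 X.1 ∈ L ∧ ∀ u, fderiv ℝ ψ p.1 u ∈ L →
        fderiv ℝ (fderiv ℝ e) p X (0, u)
          - legendreRep e ψ p (fderiv ℝ (fderiv ℝ ψ) p.1 X.1 u) = 0 := by
  rw [fderiv_cotangentCoord h j hU hψ hinv hp hpU, mem_conormalSubmodule]
  simp only [ContinuousLinearEquiv.symm_apply_apply]
  refine and_congr_right fun _ => ?_
  constructor
  · intro h1 u hu
    rw [← fderiv_legendreRep h hU hψ hinv hp hpU]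
    exact h1 _ hu
  · intro h1 l hl
    obtain ⟨A, hA⟩ := hinv _ hpU
    have h2 : fderiv ℝ ψ p.1 (A.symm l) = l := by rw [← hA]; simp
    have h3 := fderiv_legendreRep h hU hψ hinv hp hpU X (A.symm l)
    rw [h2] at h3
    rw [h3]
    exact h1 _ (by rwa [h2])

end SliceMap

/-! ### The symmetric form B and the infinitesimal Lagrangian property -/

section TangentBilin

variable {V : Type*} [NormedAddCommGroup V] [NormedSpace ℝ V]

theorem nonlinConn_add (e : V × V → ℝ) (p : V × V) (a b : V) :
    nonlinConn e p (a + b) = nonlinConn e p a + nonlinConn e p b := by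
  have h : ((0, a + b) : V × V) = (0, a) + (0, b) := by simp
  rw [nonlinConn, h, map_add, smul_add, nonlinConn, nonlinConn]

theorem nonlinConn_smul (e : V × V → ℝ) (p : V × V) (c : ℝ) (a : V) :
    nonlinConn e p (c • a) = c • nonlinConn e p a := by
  have h : ((0, c • a) : V × V) = c • (0, a) := by simp
  rw [nonlinConn, h, map_smul, nonlinConn, smul_comm]

/-- The vertical Hessian evaluated on the vertical part of `X` with respect to the canonical
nonlinear connection, minus the Hessian on `X`, corrected by the second derivative of `ψ`. -/
def tangentBilin (e : V × V → ℝ) (ψ : V → V) (p : V × V) : LinearMap.BilinForm ℝ V :=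
  LinearMap.mk₂ ℝ (fun a u => fderiv ℝ (fderiv ℝ e) p (a, -nonlinConn e p a) (0, u)
      - legendreRep e ψ p (fderiv ℝ (fderiv ℝ ψ) p.1 a u))
    (fun a b u => by
      have h : ((a + b, -nonlinConn e p (a + b)) : V × V) =
          (a, -nonlinConn e p a) + (b, -nonlinConn e p b) := by
        rw [nonlinConn_add]; ext1
        · rfl
        · simp only [Prod.snd_add]; abel
      rw [h, map_add, map_add, add_apply, add_apply, map_add]; ring)
    (fun c a u => by
      have h : ((c • a, -nonlinConn e p (c • a)) : V × V) = c • (a, -nonlinConn e p a) := by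
        rw [nonlinConn_smul]; simp
      rw [h, map_smul, map_smul, smul_apply, smul_apply, map_smul, smul_sub])
    (fun a u v => by
      have h : ((0, u + v) : V × V) = (0, u) + (0, v) := by simp
      rw [h, map_add, map_add, map_add]; ring)
    (fun c a u => by
      have h : ((0, c • u) : V × V) = c • (0, u) := by simp
      rw [h, map_smul, map_smul, map_smul, smul_sub])

theorem tangentBilin_apply (e : V × V → ℝ) (ψ : V → V) (p : V × V) (a u : V) :
    tangentBilin e ψ p a u = fderiv ℝ (fderiv ℝ e) p (a, -nonlinConn e p a) (0, u)
      - legendreRep e ψ p (fderiv ℝ (fderiv ℝ ψ) p.1 a u) := rfl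

/-- Splitting X into vertical and horizontal parts converts the derivative of the slice map into the
shape g(vertical part, u) + B(dπ X, u) required of the tangent form. -/
theorem tangentBilin_add_eq (e : V × V → ℝ) (ψ : V → V) (p X : V × V) (u : V) :
    fderiv ℝ (fderiv ℝ e) p (0, X.2 + nonlinConn e p X.1) (0, u) + tangentBilin e ψ p X.1 u =
      fderiv ℝ (fderiv ℝ e) p X (0, u)
        - legendreRep e ψ p (fderiv ℝ (fderiv ℝ ψ) p.1 X.1 u) := by
  have h : X = (0, X.2 + nonlinConn e p X.1) + (X.1, -nonlinConn e p X.1) := by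
    ext1 <;> simp
  conv_rhs => rw [h, map_add, add_apply]
  rw [tangentBilin_apply]
  simp only [Prod.fst_add, zero_add]
  ring

namespace IsEnergyOn

variable {e : V × V → ℝ} {Ω : Set (V × V)} (h : IsEnergyOn e Ω) {ψ : V → V} {U : Set V}
  [FiniteDimensional ℝ V]

include h

theorem fderiv_fderiv_horizontal_symm {p : V × V} (hp : p ∈ Ω) (a u : V) :
    fderiv ℝ (fderiv ℝ e) p (a, -nonlinConn e p a) (0, u) =
      fderiv ℝ (fderiv ℝ e) p (u, -nonlinConn e p u) (0, a) := by
  have h1 := h.nonlinConn_antisymm hp a u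
  have h2 : ∀ a : V, ((a, -nonlinConn e p a) : V × V) = (a, 0) - (0, nonlinConn e p a) := by
    intro a; simp
  rw [h2, h2, map_sub, map_sub, sub_apply, sub_apply]
  linarith

theorem tangentBilin_symm (hU : IsOpen U) (hψ : ContDiffOn ℝ ∞ ψ U)
    {p : V × V} (hp : p ∈ Ω) (hpU : p.1 ∈ U) (a u : V) :
    tangentBilin e ψ p a u = tangentBilin e ψ p u a := by
  have h1 := ((hψ.contDiffAt (hU.mem_nhds hpU)).isSymmSndFDerivAt (by
    simp only [minSmoothness_of_isRCLikeNormedField]; norm_cast)).eq a u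
  rw [tangentBilin_apply, tangentBilin_apply, h.fderiv_fderiv_horizontal_symm hp, h1]

/-- The symplectic form pairs vertical parts with projections only: the horizontal–horizontal terms
cancel by `fderiv_fderiv_horizontal_symm`. -/
theorem symplectic_eq {p : V × V} (hp : p ∈ Ω) (X Y : V × V) :
    fderiv ℝ (fderiv ℝ e) p Y (0, X.1) - fderiv ℝ (fderiv ℝ e) p X (0, Y.1) =
      fderiv ℝ (fderiv ℝ e) p (0, Y.2 + nonlinConn e p Y.1) (0, X.1)
        - fderiv ℝ (fderiv ℝ e) p (0, X.2 + nonlinConn e p X.1) (0, Y.1) := by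
  have h1 := h.fderiv_fderiv_horizontal_symm hp X.1 Y.1
  have h2 : ∀ X : V × V, X = (0, X.2 + nonlinConn e p X.1) + (X.1, -nonlinConn e p X.1) := by
    intro X; ext1 <;> simp
  have h3 : ∀ (X : V × V) (u : V), fderiv ℝ (fderiv ℝ e) p X (0, u) =
      fderiv ℝ (fderiv ℝ e) p (0, X.2 + nonlinConn e p X.1) (0, u) +
      fderiv ℝ (fderiv ℝ e) p (X.1, -nonlinConn e p X.1) (0, u) := by
    intro X u
    conv_lhs => rw [h2 X, map_add, add_apply]
  rw [h3 X, h3 Y, h1]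
  ring

/-- Nondegeneracy of the vertical Hessian solves the tangency equation for the fibre component b
over any a, even against all u rather than only those tangent to P. -/
theorem exists_tangent_vector (ψ : V → V) {p : V × V} (hp : p ∈ Ω) (a : V) :
    ∃ b, ∀ u, fderiv ℝ (fderiv ℝ e) p (0, b + nonlinConn e p a) (0, u)
      + tangentBilin e ψ p a u = 0 := by
  obtain ⟨v, hv⟩ := h.exists_vertHess_eq hp
    (LinearMap.toContinuousLinearMap (tangentBilin e ψ p (-a)))
  refine ⟨v - nonlinConn e p a, fun u => ?_⟩
  rw [sub_add_cancel, hv]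
  simp

/-- The conormal bundle is Lagrangian at the infinitesimal level. -/
theorem lagrangian_iff {p : V × V} (hp : p ∈ Ω)
    (hsymm : ∀ a u, tangentBilin e ψ p a u = tangentBilin e ψ p u a) (K : Submodule ℝ V)
    (X : V × V) :
    (X.1 ∈ K ∧ ∀ u ∈ K, fderiv ℝ (fderiv ℝ e) p (0, X.2 + nonlinConn e p X.1) (0, u)
      + tangentBilin e ψ p X.1 u = 0) ↔
    ∀ Y : V × V, (Y.1 ∈ K ∧ ∀ u ∈ K,
      fderiv ℝ (fderiv ℝ e) p (0, Y.2 + nonlinConn e p Y.1) (0, u)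
      + tangentBilin e ψ p Y.1 u = 0) →
      fderiv ℝ (fderiv ℝ e) p Y (0, X.1) - fderiv ℝ (fderiv ℝ e) p X (0, Y.1) = 0 := by
  constructor
  · rintro ⟨hX1, hX2⟩ Y ⟨hY1, hY2⟩
    rw [h.symplectic_eq hp]
    linarith [hX2 _ hY1, hY2 _ hX1, hsymm X.1 Y.1]
  · intro hX
    have hX1 : X.1 ∈ K := by
      by_contra hne
      -- A functional vanishing on K but not at X.1 is represented by a vertical vector (0, v). That
      -- vector satisfies the equations imposed on Y, yet its symplectic pairing with X is f(X.1) ≠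
      -- 0.
      obtain ⟨f, hf, hfK⟩ := Submodule.exists_dual_map_eq_bot_of_notMem hne inferInstance
      obtain ⟨v, hv⟩ := h.exists_vertHess_eq hp (LinearMap.toContinuousLinearMap f)
      have hfK' : ∀ u ∈ K, f u = 0 := fun u hu => by
        have : f u ∈ K.map f := Submodule.mem_map_of_mem hu
        rw [hfK] at this
        simpa using this
      have hn : nonlinConn e p 0 = 0 := by
        rw [nonlinConn, Prod.mk_zero_zero, map_zero, smul_zero]
      have h1 := hX (0, v) ⟨K.zero_mem, fun u hu => by
        simp only [hn, add_zero, map_zero, LinearMap.zero_apply]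
        rw [hv]
        exact hfK' u hu⟩
      rw [hv] at h1
      simp only [Prod.mk_zero_zero, map_zero, sub_zero] at h1
      exact hf h1
    refine ⟨hX1, fun u hu => ?_⟩
    -- Testing against a lift of u gives the equation for X with B(u, X.1) in place of B(X.1, u);
    -- symmetry of B then finishes.
    obtain ⟨b, hb⟩ := h.exists_tangent_vector ψ hp u
    have h1 := hX (u, b) ⟨hu, fun u' _ => hb u'⟩
    rw [h.symplectic_eq hp] at h1
    simp only at h1
    linarith [hb X.1, hsymm u X.1]

end IsEnergyOn

end TangentBilin

/-! ### The normal bundle is a Lagrangian submanifold -/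

section NormalBundle

variable {E : Type*} [NormedAddCommGroup E] [NormedSpace ℝ E] [FiniteDimensional ℝ E]
  {M : Type*} [TopologicalSpace M] [ChartedSpace E M] [IsManifold 𝓘(ℝ, E) ∞ M]

/-- In the preferred chart at `x₀`, the diffeomorphism `ψ` flattens `P` to the subspace `L`. -/
structure IsSlice (P : Set M) (x₀ : M) (ψ : E → E) (U : Set E) (L : Submodule ℝ E) : Prop where
  isOpen : IsOpen U
  mem_base : extChartAt 𝓘(ℝ, E) x₀ x₀ ∈ U
  contDiffOn : ContDiffOn ℝ ∞ ψ U
  isInvertible : ∀ q ∈ U, (fderiv ℝ ψ q).IsInvertible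
  mem_iff : ∀ y ∈ (extChartAt 𝓘(ℝ, E) x₀).source, extChartAt 𝓘(ℝ, E) x₀ y ∈ U →
    (y ∈ P ↔ ψ (extChartAt 𝓘(ℝ, E) x₀ y) - ψ (extChartAt 𝓘(ℝ, E) x₀ x₀) ∈ L)
  mem_tangent_iff : ∀ y ∈ (extChartAt 𝓘(ℝ, E) x₀).source, extChartAt 𝓘(ℝ, E) x₀ y ∈ U → y ∈ P →
    ∀ v : TangentSpace 𝓘(ℝ, E) y, (v ∈ tangentSpaceOf 𝓘(ℝ, E) P y ↔
      fderiv ℝ ψ (extChartAt 𝓘(ℝ, E) x₀ y) (chartDeriv 𝓘(ℝ, E) x₀ y v) ∈ L)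

/-- A slice chart of P composed with the inverse of the preferred chart. Everything is then
expressed in the preferred chart, where the energy and the connection are known. -/
theorem exists_isSlice {P : Set M} (hP : IsEmbeddedSubmanifold 𝓘(ℝ, E) P) {x₀ : M}
    (hx : x₀ ∈ P) : ∃ ψ U L, IsSlice (E := E) P x₀ ψ U L := by
  obtain ⟨φ, hφ, hxφ, L, hL⟩ := hP x₀ hx
  obtain ⟨hUo, hψ⟩ := contDiffOn_extend_comp_chart_symm hφ x₀
  set e := extChartAt 𝓘(ℝ, E) x₀ with he
  set ψ : E → E := φ.extend 𝓘(ℝ, E) ∘ e.symm with hψdef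
  set U : Set E := e.target ∩ e.symm ⁻¹' φ.source with hU
  have hmemU : ∀ y ∈ e.source, e y ∈ U → y ∈ φ.source := by
    intro y hy h
    have h2 : e.symm (e y) ∈ φ.source := h.2
    rwa [e.left_inv hy] at h2
  have hψe : ∀ y ∈ e.source, ψ (e y) = φ.extend 𝓘(ℝ, E) y := by
    intro y hy
    rw [hψdef, Function.comp_apply, e.left_inv hy]
  have hdiff : ∀ q ∈ U, DifferentiableAt ℝ ψ q := fun q hq =>
    (hψ.contDiffAt (hUo.mem_nhds hq)).differentiableAt (by simp)
  have hd : ∀ y ∈ e.source, e y ∈ U → ∀ v : TangentSpace 𝓘(ℝ, E) y,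
      mvfderiv 𝓘(ℝ, E) (φ.extend 𝓘(ℝ, E)) y v =
        fderiv ℝ ψ (e y) (chartDeriv 𝓘(ℝ, E) x₀ y v) := fun y hy hyU v =>
    mvfderiv_eq_fderiv_rep hy (hdiff _ hyU) v
  have hx₀ : x₀ ∈ e.source := mem_extChartAt_source x₀
  refine ⟨ψ, U, L, hUo, ⟨e.map_source hx₀, ?_⟩, hψ, ?_, ?_, ?_⟩
  · rw [mem_preimage, e.left_inv hx₀]; exact hxφ
  · intro q hq
    have hy := e.map_target hq.1
    have hr := e.right_inv hq.1
    apply isInvertible_of_injective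
    rw [injective_iff_map_eq_zero]
    intro a ha
    obtain ⟨v, rfl⟩ := chartDeriv_surjective hy a
    have h1 := hd _ hy (by rwa [hr]) v
    rw [hr, ha] at h1
    have h2 : v = 0 := mvfderiv_extend_injective hφ hq.2 (by rw [h1, map_zero])
    rw [h2, map_zero]
  · intro y hy hyU
    rw [hL y (hmemU y hy hyU), hψe y hy, hψe x₀ hx₀]
  · intro y hy hyU hyP v
    rw [mem_tangentSpaceOf_iff hφ hL (hmemU y hy hyU) hyP v, hd y hy hyU]

namespace FinslerMetric

variable (F : FinslerMetric E M) {P : Set M}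

omit [FiniteDimensional ℝ E] in
-- Orthogonality to w in g_w is vanishing of ∂_y e, and Dψ carries T_xP onto L. The normality
-- condition is thus that λ annihilates the fixed subspace L.
theorem mem_normalBundle_iff {η z : TM E M} {ψ : E → E} {U : Set E}
    {L : Submodule ℝ E} (hS : IsSlice P η.proj ψ U L)
    (hz : z.proj ∈ (extChartAt 𝓘(ℝ, E) η.proj).source) (hs : z ∈ slit E M)
    (hzU : (extChartAt 𝓘(ℝ, E).tangent η z).1 ∈ U) :
    z ∈ F.normalBundle P ↔
      ψ (extChartAt 𝓘(ℝ, E).tangent η z).1 - ψ (extChartAt 𝓘(ℝ, E).tangent η η).1 ∈ L ∧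
      ∀ l ∈ L, legendreRep (F.energyRep η) ψ (extChartAt 𝓘(ℝ, E).tangent η z) l = 0 := by
  rw [forall_legendreRep_eq_zero_iff (hS.isInvertible _ hzU)]
  have h1 : ∀ z : TM E M, z.proj ∈ (extChartAt 𝓘(ℝ, E) η.proj).source →
      (extChartAt 𝓘(ℝ, E).tangent η z).1 = extChartAt 𝓘(ℝ, E) η.proj z.proj := by
    intro z hz
    rw [tangent_extChartAt_apply hz]
  rw [h1 z hz] at hzU ⊢
  rw [h1 η (mem_extChartAt_source _), ← hS.mem_iff _ hz hzU]
  constructor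
  · rintro ⟨hzP, -, hu⟩
    refine ⟨hzP, fun u hu' => ?_⟩
    obtain ⟨u, rfl⟩ := chartDeriv_surjective hz u
    rw [← F.g_self_left_eq hz hs]
    exact hu u ((hS.mem_tangent_iff _ hz hzU hzP u).2 hu')
  · rintro ⟨hzP, hu⟩
    refine ⟨hzP, hs, fun u hu' => ?_⟩
    rw [F.g_self_left_eq hz hs]
    exact hu _ ((hS.mem_tangent_iff _ hz hzU hzP u).1 hu')

theorem exists_slice_normalBundle {η : TM E M} (hη : η ∈ F.normalBundle P) {ψ : E → E} {U : Set E}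
    {L : Submodule ℝ E} (hS : IsSlice P η.proj ψ U L) (j : (E →L[ℝ] ℝ) ≃L[ℝ] E) :
    ∃ φ ∈ IsManifold.maximalAtlas 𝓘(ℝ, E).tangent ∞ (TM E M), η ∈ φ.source ∧
      (∀ z ∈ φ.source, (z ∈ F.normalBundle P ↔
        φ.extend 𝓘(ℝ, E).tangent z - φ.extend 𝓘(ℝ, E).tangent η ∈ conormalSubmodule j L)) ∧
      ∀ z ∈ φ.source, φ.extend 𝓘(ℝ, E).tangent z =
        cotangentCoord j (F.energyRep η) ψ (extChartAt 𝓘(ℝ, E).tangent η z) := by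
  have hηs := mem_extChartAt_source (I := 𝓘(ℝ, E)) η.proj
  have hηs' := mem_extChartAt_source (I := 𝓘(ℝ, E).tangent) η
  have hη0 : η ∈ slit E M := hη.2.1
  have hp := (mem_slitRange_iff hηs).2 hη0
  have hηU : (extChartAt 𝓘(ℝ, E).tangent η η).1 ∈ U := by
    rw [tangent_extChartAt_apply hηs]; exact hS.mem_base
  have hev : ∀ᶠ z in 𝓝 η, (z.proj ∈ (extChartAt 𝓘(ℝ, E) η.proj).source ∧ z ∈ slit E M) ∧
      (extChartAt 𝓘(ℝ, E).tangent η z).1 ∈ U := by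
    refine (isOpen_slit_of_chart hηs hη0).and ?_
    have hc : ContinuousAt (extChartAt 𝓘(ℝ, E).tangent η) η := continuousAt_extChartAt η
    exact (continuous_fst.continuousAt.comp hc).eventually (hS.isOpen.mem_nhds hηU)
  obtain ⟨φ, hφ, hηφ, h⟩ := exists_mem_maximalAtlas_of_rep hηs'
    (((isOpen_slitRange η).inter (hS.isOpen.preimage continuous_fst))) ⟨hp, hηU⟩
    (contDiffOn_cotangentCoord (F.isEnergyOn η) j hS.isOpen hS.contDiffOn hS.isInvertible)
    (isInvertible_fderiv_cotangentCoord (F.isEnergyOn η) j hS.isOpen hS.contDiffOn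
      hS.isInvertible hp hηU) hev
  refine ⟨φ, hφ, hηφ, fun z hz => ?_, fun z hz => (h z hz).2.2⟩
  obtain ⟨-, ⟨⟨hz1, hz2⟩, hz3⟩, hz4⟩ := h z hz
  rw [F.mem_normalBundle_iff hS hz1 hz2 hz3, hz4, (h η hηφ).2.2, mem_conormalSubmodule]
  -- At η itself λ already annihilates L, so subtracting the value at η does not change the
  -- condition; the slice is centred at η as the definition of an embedded submanifold demands.
  have h0 := ((F.mem_normalBundle_iff hS hηs hη0 hηU).1 hη).2
  refine and_congr_right fun _ => forall₂_congr fun l hl => ?_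
  simp only [cotangentCoord, Prod.snd_sub, map_sub, ContinuousLinearEquiv.symm_apply_apply,
    sub_apply]
  rw [h0 l hl, sub_zero]

theorem isEmbeddedSubmanifold_normalBundle (hP : IsEmbeddedSubmanifold 𝓘(ℝ, E) P) :
    IsEmbeddedSubmanifold 𝓘(ℝ, E).tangent (F.normalBundle P) := by
  intro η hη
  obtain ⟨ψ, U, L, hS⟩ := exists_isSlice hP hη.1
  obtain ⟨j⟩ := nonempty_dual_equiv (V := E)
  obtain ⟨φ, hφ, hηφ, h, -⟩ := F.exists_slice_normalBundle hη hS j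
  exact ⟨φ, hφ, hηφ, conormalSubmodule j L, h⟩

/-- The tangent space is the preimage of the conormal subspace under the derivative of the slice
map, rewritten through the vertical–horizontal splitting. -/
theorem mem_tangentSpaceOf_normalBundle_iff {η : TM E M} (hη : η ∈ F.normalBundle P) {ψ : E → E}
    {U : Set E} {L : Submodule ℝ E} (hS : IsSlice P η.proj ψ U L) (X : TTM η) :
    X ∈ tangentSpaceOf 𝓘(ℝ, E).tangent (F.normalBundle P) η ↔
      (chartDeriv 𝓘(ℝ, E).tangent η η X).1 ∈
          L.comap (fderiv ℝ ψ (extChartAt 𝓘(ℝ, E).tangent η η).1 : E →ₗ[ℝ] E) ∧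
      ∀ u ∈ L.comap (fderiv ℝ ψ (extChartAt 𝓘(ℝ, E).tangent η η).1 : E →ₗ[ℝ] E),
        fderiv ℝ (fderiv ℝ (F.energyRep η)) (extChartAt 𝓘(ℝ, E).tangent η η)
          (0, (chartDeriv 𝓘(ℝ, E).tangent η η X).2 +
            nonlinConn (F.energyRep η) (extChartAt 𝓘(ℝ, E).tangent η η)
              (chartDeriv 𝓘(ℝ, E).tangent η η X).1) (0, u)
        + tangentBilin (F.energyRep η) ψ (extChartAt 𝓘(ℝ, E).tangent η η)
            (chartDeriv 𝓘(ℝ, E).tangent η η X).1 u = 0 := by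
  have hηs := mem_extChartAt_source (I := 𝓘(ℝ, E)) η.proj
  have hηs' := mem_extChartAt_source (I := 𝓘(ℝ, E).tangent) η
  have hp := (mem_slitRange_iff hηs).2 hη.2.1
  have hηU : (extChartAt 𝓘(ℝ, E).tangent η η).1 ∈ U := by
    rw [tangent_extChartAt_apply hηs]; exact hS.mem_base
  obtain ⟨j⟩ := nonempty_dual_equiv (V := E)
  obtain ⟨φ, hφ, hηφ, h, hφe⟩ := F.exists_slice_normalBundle hη hS j
  rw [mem_tangentSpaceOf_iff hφ h hηφ hη]
  have hrep : φ.extend 𝓘(ℝ, E).tangent ∘ (extChartAt 𝓘(ℝ, E).tangent η).symm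
      =ᶠ[𝓝 (extChartAt 𝓘(ℝ, E).tangent η η)] cotangentCoord j (F.energyRep η) ψ := by
    filter_upwards [extChartAt_target_mem_nhds (I := 𝓘(ℝ, E).tangent) η,
      extChartAt_symm_mem_of_eventually hηs' (φ.open_source.mem_nhds hηφ)] with q hq1 hq2
    rw [Function.comp_apply, hφe _ hq2, (extChartAt 𝓘(ℝ, E).tangent η).right_inv hq1]
  have hd : DifferentiableAt ℝ (cotangentCoord j (F.energyRep η) ψ)
      (extChartAt 𝓘(ℝ, E).tangent η η) :=
    ((contDiffOn_cotangentCoord (F.isEnergyOn η) j hS.isOpen hS.contDiffOn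
      hS.isInvertible).contDiffAt (((isOpen_slitRange η).inter
        (hS.isOpen.preimage continuous_fst)).mem_nhds ⟨hp, hηU⟩)).differentiableAt (by simp)
  rw [mvfderiv_eq_fderiv_rep hηs' (hrep.differentiableAt_iff.2 hd) X, hrep.fderiv_eq,
    fderiv_cotangentCoord_mem_iff (F.isEnergyOn η) j hS.isOpen hS.contDiffOn hS.isInvertible
      hp hηU]
  simp only [tangentBilin_add_eq]
  rfl

theorem isLagrangianSubmanifold_normalBundle (hP : IsEmbeddedSubmanifold 𝓘(ℝ, E) P) :
    IsLagrangianSubmanifold 𝓘(ℝ, E).tangent F.omega (F.normalBundle P) := by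
  refine ⟨F.isEmbeddedSubmanifold_normalBundle hP, fun η hη X => ?_⟩
  obtain ⟨ψ, U, L, hS⟩ := exists_isSlice hP hη.1
  have hηs := mem_extChartAt_source (I := 𝓘(ℝ, E)) η.proj
  have hηs' := mem_extChartAt_source (I := 𝓘(ℝ, E).tangent) η
  have hp := (mem_slitRange_iff hηs).2 hη.2.1
  have hηU : (extChartAt 𝓘(ℝ, E).tangent η η).1 ∈ U := by
    rw [tangent_extChartAt_apply hηs]; exact hS.mem_base
  simp only [F.mem_tangentSpaceOf_normalBundle_iff hη hS]
  rw [(F.isEnergyOn η).lagrangian_iff hp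
    ((F.isEnergyOn η).tangentBilin_symm hS.isOpen hS.contDiffOn hp hηU)]
  simp only [F.omega_eq hηs hη.2.1]
  constructor
  · intro h Y hY
    exact h _ hY
  · intro h Y hY
    obtain ⟨Y, rfl⟩ := chartDeriv_surjective hηs' Y
    exact h Y hY

end FinslerMetric

end NormalBundle

/-! ### Functions that vanish on a submanifold -/

section General

variable {E : Type*} [NormedAddCommGroup E] [NormedSpace ℝ E]
  {H : Type*} [TopologicalSpace H] {I : ModelWithCorners ℝ E H}
  {M : Type*} [TopologicalSpace M] [ChartedSpace H M]
  {F : Type*} [NormedAddCommGroup F] [NormedSpace ℝ F]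

theorem mvfderiv_eq_zero_of_mem_tangentSpaceOf {P : Set M} {x : M} {g : M → F}
    (hg : MDifferentiableAt I 𝓘(ℝ, F) g x) (h0 : ∀ᶠ y in 𝓝 x, y ∈ P → g y = 0)
    {v : TangentSpace I x} (hv : v ∈ tangentSpaceOf I P x) : mvfderiv I g x v = 0 := by
  have hle : tangentSpaceOf I P x ≤ LinearMap.ker (mvfderiv I g x : TangentSpace I x →ₗ[ℝ] F) := by
    refine Submodule.span_le.2 ?_
    rintro v ⟨ε, hε, c, hc, hcP, hv⟩
    have hc0 : ContMDiffAt 𝓘(ℝ, ℝ) I ∞ c 0 :=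
      hc.contMDiffAt (Ioo_mem_nhds (by linarith) hε)
    obtain ⟨rfl, hd⟩ := hasDerivAt_comp_of_tangentMap_eq (hc0.mdifferentiableAt (by simp)) hv hg
    have hz : g ∘ c =ᶠ[𝓝 0] fun _ => 0 := by
      filter_upwards [hc0.continuousAt.eventually h0,
        Ioo_mem_nhds (show -ε < 0 by linarith) hε] with t ht1 ht2
      exact ht1 (hcP t ht2)
    exact hd.unique ((hasDerivAt_const (0 : ℝ) (0 : F)).congr_of_eventuallyEq hz)
  exact hle hv

theorem fieldRep_extChartAt {x₀ x : M} (hx : x ∈ (extChartAt I x₀).source)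
    (V : Π x : M, TangentSpace I x) :
    fieldRep I x₀ V (extChartAt I x₀ x) = chartDeriv I x₀ x (V x) := by
  rw [fieldRep, (extChartAt I x₀).left_inv hx]

end General

/-! ### The second fundamental form and its comparison with the tangent form -/

section SecondFundamentalForm

variable {E : Type*} [NormedAddCommGroup E] [NormedSpace ℝ E]
  {M : Type*} [TopologicalSpace M] [ChartedSpace E M] [IsManifold 𝓘(ℝ, E) ∞ M]

theorem dpi_vlift (w : TM E M) (u : TangentSpace 𝓘(ℝ, E) w.proj) : dpi w (vlift w u) = 0 := by
  have h := mem_extChartAt_source (I := 𝓘(ℝ, E)) w.proj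
  apply chartDeriv_injective h
  rw [chartDeriv_dpi h, chartDeriv_vlift h, map_zero]

theorem isVerticalSectionOn_vliftField {V : Π x : M, TangentSpace 𝓘(ℝ, E) x} {O : Set M}
    (hO : IsOpen O) (hV : IsSmoothFieldOn 𝓘(ℝ, E) V O) {O' : Set (TM E M)}
    (hO' : ∀ w ∈ O', w.proj ∈ O) : IsVerticalSectionOn (vliftField V) O' := by
  refine ⟨fun w hw => ContMDiffAt.contMDiffWithinAt ?_, fun w _ => dpi_vlift w _⟩
  have hs := mem_extChartAt_source (I := 𝓘(ℝ, E)) w.proj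
  have hs' := mem_extChartAt_source (I := 𝓘(ℝ, E).tangent) w
  have h1 := (contMDiffAt_field_iff hs V).1 (hV.contMDiffAt (hO.mem_nhds (hO' w hw)))
  rw [contMDiffAt_field_iff hs']
  have hfst : (extChartAt 𝓘(ℝ, E).tangent w w).1 = extChartAt 𝓘(ℝ, E) w.proj w.proj := by
    rw [tangent_extChartAt_apply hs]
  rw [← hfst] at h1
  refine ContDiffAt.congr_of_eventuallyEq (f := fun q : E × E =>
    ((0 : E), fieldRep 𝓘(ℝ, E) w.proj V q.1))
    (contDiffAt_const.prodMk (h1.comp _ contDiffAt_fst)) ?_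
  filter_upwards [extChartAt_target_mem_nhds (I := 𝓘(ℝ, E).tangent) w] with q hq
  have hq1 := mem_tangent_extChartAt_source.1 ((extChartAt 𝓘(ℝ, E).tangent w).map_target hq)
  rw [tangent_extChartAt_target] at hq
  rw [fieldRep, vliftField, chartDeriv_vlift hq1, fieldRep, ← tangent_extChartAt_symm_proj hq.1]

namespace FinslerMetric

variable (F : FinslerMetric E M)

theorem g_comm {z : TM E M} (hs : z ∈ slit E M) (u v : TangentSpace 𝓘(ℝ, E) z.proj) :
    F.g z u v = F.g z v u := by
  have h := mem_extChartAt_source (I := 𝓘(ℝ, E)) z.proj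
  rw [F.g_eq h hs, (F.isEnergyOn z).symm ((mem_slitRange_iff h).2 hs), ← F.g_eq h hs]

theorem gV_vliftField_canonicalField {w₀ z : TM E M}
    (hz : z.proj ∈ (extChartAt 𝓘(ℝ, E) w₀.proj).source) (hs : z ∈ slit E M)
    (V : Π x : M, TangentSpace 𝓘(ℝ, E) x) :
    F.gV z (vliftField V z) (canonicalField z) =
      fderiv ℝ (F.energyRep w₀) (extChartAt 𝓘(ℝ, E).tangent w₀ z)
        (0, fieldRep 𝓘(ℝ, E) w₀.proj V (extChartAt 𝓘(ℝ, E).tangent w₀ z).1) := by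
  rw [gV, vliftField, canonicalField, vliftInv_vlift, vliftInv_vlift, F.g_comm hs,
    F.g_self_left_eq hz hs, tangent_extChartAt_apply hz, fieldRep_extChartAt hz]

variable [FiniteDimensional ℝ E]

theorem verticalProj_hlift {w : TM E M} (hw : w ∈ slit E M)
    (u : TangentSpace 𝓘(ℝ, E) w.proj) : verticalProj F.spray w (hlift F.spray w u) = 0 := by
  apply chartDeriv_injective (mem_extChartAt_source (I := 𝓘(ℝ, E).tangent) w)
  rw [F.chartDeriv_verticalProj hw, F.chartDeriv_hlift hw, map_zero]
  simp

/-- (M1) is applied to V^𝔳 in the direction u^𝔥. For a lift, ∇C is the vertical projection, which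
kills u^𝔥, so only the derivative of g(V^𝔳, C) remains. In coordinates this function is ∂_y e(V),
and the two summands are its product rule. -/
theorem g_self_affine {N : VerticalConnection E M} (hN : N.IsLift F.spray) (hM : F.M1 N)
    {η : TM E M} (hη : η ∈ slit E M) (u : TangentSpace 𝓘(ℝ, E) η.proj)
    {V : Π x : M, TangentSpace 𝓘(ℝ, E) x} {O : Set M} (hO : IsOpen O) (hηO : η.proj ∈ O)
    (hV : IsSmoothFieldOn 𝓘(ℝ, E) V O) :
    F.g η η.2 (N.affine F.spray η u V) =
      fderiv ℝ (fderiv ℝ (F.energyRep η)) (extChartAt 𝓘(ℝ, E).tangent η η)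
        (chartDeriv 𝓘(ℝ, E) η.proj η.proj u,
          -nonlinConn (F.energyRep η) (extChartAt 𝓘(ℝ, E).tangent η η)
            (chartDeriv 𝓘(ℝ, E) η.proj η.proj u))
        (0, chartDeriv 𝓘(ℝ, E) η.proj η.proj (V η.proj))
      + fderiv ℝ (F.energyRep η) (extChartAt 𝓘(ℝ, E).tangent η η)
        (0, fderiv ℝ (fieldRep 𝓘(ℝ, E) η.proj V) (extChartAt 𝓘(ℝ, E) η.proj η.proj)
          (chartDeriv 𝓘(ℝ, E) η.proj η.proj u)) := by
  have hs := mem_extChartAt_source (I := 𝓘(ℝ, E)) η.proj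
  have hs' := mem_extChartAt_source (I := 𝓘(ℝ, E).tangent) η
  have hp := (mem_slitRange_iff hs).2 hη
  set p := extChartAt 𝓘(ℝ, E).tangent η η with hpdef
  have hfst : p.1 = extChartAt 𝓘(ℝ, E) η.proj η.proj := by
    rw [hpdef, tangent_extChartAt_apply hs]
  have hcont : Continuous fun z : TM E M => z.proj := FiberBundle.continuous_proj E _
  have hrep : (fun z => F.gV z (vliftField V z) (canonicalField z)) ∘
      (extChartAt 𝓘(ℝ, E).tangent η).symm =ᶠ[𝓝 p] fun q =>
        fderiv ℝ (F.energyRep η) q (0, fieldRep 𝓘(ℝ, E) η.proj V q.1) := by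
    filter_upwards [extChartAt_target_mem_nhds (I := 𝓘(ℝ, E).tangent) η,
      extChartAt_symm_mem_of_eventually hs' (isOpen_slit_of_chart hs hη)] with q hq1 hq2
    rw [Function.comp_apply, F.gV_vliftField_canonicalField hq2.1 hq2.2,
      (extChartAt 𝓘(ℝ, E).tangent η).right_inv hq1]
  have hVd : HasFDerivAt (fieldRep 𝓘(ℝ, E) η.proj V)
      (fderiv ℝ (fieldRep 𝓘(ℝ, E) η.proj V) p.1) p.1 := by
    rw [hfst]
    exact (((contMDiffAt_field_iff hs V).1
      (hV.contMDiffAt (hO.mem_nhds hηO))).differentiableAt (by simp)).hasFDerivAt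
  have hd : HasFDerivAt (fun q : E × E =>
      fderiv ℝ (F.energyRep η) q (0, fieldRep 𝓘(ℝ, E) η.proj V q.1)) _ p :=
    ((F.isEnergyOn η).hasFDerivAt_fderiv hp).clm_apply
      ((hasFDerivAt_const (0 : E) p).prodMk (hVd.comp p hasFDerivAt_fst))
  have hm := hM {z | z.proj ∈ O ∧ z ∈ slit E M} ((hO.preimage hcont).inter isOpen_slit)
    (fun z hz => hz.2) (vliftField V) (isVerticalSectionOn_vliftField hO hV fun z hz => hz.1)
    η ⟨hηO, hη⟩ (hlift F.spray η u)
  have h0 : vliftInv η (0 : TTM η) = 0 := by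
    have h1 : vlift η 0 = 0 := by
      apply chartDeriv_injective hs'
      rw [chartDeriv_vlift hs, map_zero, map_zero]; rfl
    rw [← h1, vliftInv_vlift]
  have h2 : F.gV η (vliftField V η) (N.D η (hlift F.spray η u) canonicalField) = 0 := by
    rw [hN η hη, F.verticalProj_hlift hη, gV, h0, F.g_eq hs hη, map_zero]
    exact map_zero _
  have h3 : F.gV η (N.D η (hlift F.spray η u) (vliftField V)) (canonicalField η) =
      F.g η η.2 (N.affine F.spray η u V) := by
    rw [gV, canonicalField, vliftInv_vlift, F.g_comm hη]; rfl
  rw [h2, h3, sub_zero, sub_eq_zero] at hm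
  rw [← hm, mvfderiv_eq_fderiv_rep hs' (hrep.differentiableAt_iff.2 hd.differentiableAt),
    hrep.fderiv_eq, hd.fderiv, F.chartDeriv_hlift hη, ← hpdef, ← fieldRep_extChartAt hs, ← hfst, add_comm]
  rfl

/-- Since Dψ·V takes values in L along P, its derivative Dψ(DV·u) + D²ψ(u, V) in a direction u
tangent to P lies in L. The covector λ at η annihilates L because η is normal, and λ ∘ Dψ = ∂_y e.
-/
theorem legendreRep_tangent_field {P : Set M} {η : TM E M} (hη : η ∈ F.normalBundle P)
    {ψ : E → E} {U : Set E} {L : Submodule ℝ E} (hS : IsSlice P η.proj ψ U L)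
    {u : TangentSpace 𝓘(ℝ, E) η.proj} (hu : u ∈ tangentSpaceOf 𝓘(ℝ, E) P η.proj)
    {V : Π x : M, TangentSpace 𝓘(ℝ, E) x} {O : Set M} (hO : IsOpen O) (hηO : η.proj ∈ O)
    (hV : IsSmoothFieldOn 𝓘(ℝ, E) V O)
    (hVP : ∀ y ∈ O ∩ P, V y ∈ tangentSpaceOf 𝓘(ℝ, E) P y) :
    fderiv ℝ (F.energyRep η) (extChartAt 𝓘(ℝ, E).tangent η η)
        (0, fderiv ℝ (fieldRep 𝓘(ℝ, E) η.proj V) (extChartAt 𝓘(ℝ, E) η.proj η.proj)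
          (chartDeriv 𝓘(ℝ, E) η.proj η.proj u)) =
      -legendreRep (F.energyRep η) ψ (extChartAt 𝓘(ℝ, E).tangent η η)
        (fderiv ℝ (fderiv ℝ ψ) (extChartAt 𝓘(ℝ, E).tangent η η).1
          (chartDeriv 𝓘(ℝ, E) η.proj η.proj u)
          (chartDeriv 𝓘(ℝ, E) η.proj η.proj (V η.proj))) := by
  have hs := mem_extChartAt_source (I := 𝓘(ℝ, E)) η.proj
  set p := extChartAt 𝓘(ℝ, E).tangent η η with hpdef
  set e := extChartAt 𝓘(ℝ, E) η.proj with he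
  have hfst : p.1 = e η.proj := by rw [hpdef, tangent_extChartAt_apply hs]
  have hpU : p.1 ∈ U := by rw [hfst]; exact hS.mem_base
  have hfield : ∀ y ∈ e.source, fieldRep 𝓘(ℝ, E) η.proj V (e y) =
      chartDeriv 𝓘(ℝ, E) η.proj y (V y) := fun y hy => fieldRep_extChartAt hy V
  obtain ⟨q, hq⟩ := exists_clm_ker_eq L
  have hVd : HasFDerivAt (fieldRep 𝓘(ℝ, E) η.proj V)
      (fderiv ℝ (fieldRep 𝓘(ℝ, E) η.proj V) (e η.proj)) (e η.proj) :=
    (((contMDiffAt_field_iff hs V).1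
      (hV.contMDiffAt (hO.mem_nhds hηO))).differentiableAt (by simp)).hasFDerivAt
  have hψ : HasFDerivAt (fderiv ℝ ψ) (fderiv ℝ (fderiv ℝ ψ) (e η.proj)) (e η.proj) :=
    ((((hS.contDiffOn.contDiffAt (hS.isOpen.mem_nhds hS.mem_base)).fderiv_right
      (m := ∞) (by simp))).differentiableAt (by simp)).hasFDerivAt
  have hd := q.hasFDerivAt.comp (e η.proj) (hψ.clm_apply hVd)
  -- The map q has kernel L, so f vanishes on P near the base point and its derivative along u is
  -- zero.
  set f : M → E := fun y => q (fderiv ℝ ψ (e y) (fieldRep 𝓘(ℝ, E) η.proj V (e y))) with hf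
  have hrep : f ∘ e.symm =ᶠ[𝓝 (e η.proj)]
      q ∘ fun a => fderiv ℝ ψ a (fieldRep 𝓘(ℝ, E) η.proj V a) := by
    filter_upwards [extChartAt_target_mem_nhds (I := 𝓘(ℝ, E)) η.proj] with a ha
    simp only [hf, Function.comp_apply, e.right_inv ha]
  have hdf : DifferentiableAt ℝ (f ∘ e.symm) (e η.proj) :=
    hrep.differentiableAt_iff.2 hd.differentiableAt
  have hc : ContinuousAt e η.proj := continuousAt_extChartAt η.proj
  have hf0 : mvfderiv 𝓘(ℝ, E) f η.proj u = 0 := by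
    refine mvfderiv_eq_zero_of_mem_tangentSpaceOf (mdifferentiableAt_of_rep hs hdf) ?_ hu
    filter_upwards [eventually_mem_extChartAt_source hs, hO.mem_nhds hηO,
      hc.eventually (hS.isOpen.mem_nhds hS.mem_base)] with y hy1 hy2 hy3 hyP
    rw [hf]
    simp only [hfield y hy1]
    exact (hq _).1 ((hS.mem_tangent_iff y hy1 hy3 hyP _).1 (hVP y ⟨hy2, hyP⟩))
  rw [mvfderiv_eq_fderiv_rep hs hdf, hrep.fderiv_eq, hd.fderiv] at hf0
  have hmem : fderiv ℝ ψ (e η.proj) (fderiv ℝ (fieldRep 𝓘(ℝ, E) η.proj V) (e η.proj)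
        (chartDeriv 𝓘(ℝ, E) η.proj η.proj u)) +
      fderiv ℝ (fderiv ℝ ψ) (e η.proj) (chartDeriv 𝓘(ℝ, E) η.proj η.proj u)
        (fieldRep 𝓘(ℝ, E) η.proj V (e η.proj)) ∈ L := (hq _).2 hf0
  have hl := ((F.mem_normalBundle_iff hS hs hη.2.1 hpU).1 hη).2 _ hmem
  rw [← hpdef, ← hfst, map_add, legendreRep_apply (hS.isInvertible _ hpU), hfst,
    hfield _ hs] at hl
  rw [hfst]
  linarith

theorem g_self_affine_of_tangent {N : VerticalConnection E M} (hN : N.IsLift F.spray)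
    (hM : F.M1 N) {P : Set M} {η : TM E M} (hη : η ∈ F.normalBundle P)
    {ψ : E → E} {U : Set E} {L : Submodule ℝ E} (hS : IsSlice P η.proj ψ U L)
    {u : TangentSpace 𝓘(ℝ, E) η.proj} (hu : u ∈ tangentSpaceOf 𝓘(ℝ, E) P η.proj)
    {V : Π x : M, TangentSpace 𝓘(ℝ, E) x} {O : Set M} (hO : IsOpen O) (hηO : η.proj ∈ O)
    (hV : IsSmoothFieldOn 𝓘(ℝ, E) V O)
    (hVP : ∀ y ∈ O ∩ P, V y ∈ tangentSpaceOf 𝓘(ℝ, E) P y) :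
    F.g η η.2 (N.affine F.spray η u V) =
      tangentBilin (F.energyRep η) ψ (extChartAt 𝓘(ℝ, E).tangent η η)
        (chartDeriv 𝓘(ℝ, E) η.proj η.proj u)
        (chartDeriv 𝓘(ℝ, E) η.proj η.proj (V η.proj)) := by
  rw [F.g_self_affine hN hM hη.2.1 u hO hηO hV,
    F.legendreRep_tangent_field hη hS hu hO hηO hV hVP, tangentBilin_apply, sub_eq_add_neg]

end FinslerMetric

/-- The vector field near `x₀` whose components with respect to `ψ` are constant, with value `u`
at `x₀`. -/
def constantExtension (ψ : E → E) {x₀ : M} (u : TangentSpace 𝓘(ℝ, E) x₀) (y : M) :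
    TangentSpace 𝓘(ℝ, E) y :=
  (chartDeriv 𝓘(ℝ, E) x₀ y).inverse ((fderiv ℝ ψ (extChartAt 𝓘(ℝ, E) x₀ y)).inverse
    (fderiv ℝ ψ (extChartAt 𝓘(ℝ, E) x₀ x₀) (chartDeriv 𝓘(ℝ, E) x₀ x₀ u)))

namespace IsSlice

variable [FiniteDimensional ℝ E] {P : Set M} {x₀ : M} {ψ : E → E} {U : Set E} {L : Submodule ℝ E}

omit [FiniteDimensional ℝ E] [IsManifold 𝓘(ℝ, E) ∞ M] in
theorem isOpen_source_inter (hS : IsSlice P x₀ ψ U L) :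
    IsOpen ((extChartAt 𝓘(ℝ, E) x₀).source ∩ extChartAt 𝓘(ℝ, E) x₀ ⁻¹' U) :=
  (continuousOn_extChartAt x₀).isOpen_inter_preimage (isOpen_extChartAt_source x₀) hS.isOpen

omit [FiniteDimensional ℝ E] in
theorem chartDeriv_constantExtension (u : TangentSpace 𝓘(ℝ, E) x₀) {y : M}
    (hy : y ∈ (extChartAt 𝓘(ℝ, E) x₀).source) :
    chartDeriv 𝓘(ℝ, E) x₀ y (constantExtension ψ u y) =
      (fderiv ℝ ψ (extChartAt 𝓘(ℝ, E) x₀ y)).inverse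
        (fderiv ℝ ψ (extChartAt 𝓘(ℝ, E) x₀ x₀) (chartDeriv 𝓘(ℝ, E) x₀ x₀ u)) := by
  rw [constantExtension, (chartDeriv_isInvertible hy).self_apply_inverse]

omit [FiniteDimensional ℝ E] in
theorem constantExtension_self (hS : IsSlice P x₀ ψ U L) (u : TangentSpace 𝓘(ℝ, E) x₀) :
    constantExtension ψ u x₀ = u := by
  have hs := mem_extChartAt_source (I := 𝓘(ℝ, E)) x₀
  apply chartDeriv_injective hs
  rw [chartDeriv_constantExtension u hs, (hS.isInvertible _ hS.mem_base).inverse_apply_self]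

omit [FiniteDimensional ℝ E] in
theorem constantExtension_mem (hS : IsSlice P x₀ ψ U L) (hx : x₀ ∈ P)
    {u : TangentSpace 𝓘(ℝ, E) x₀} (hu : u ∈ tangentSpaceOf 𝓘(ℝ, E) P x₀) {y : M}
    (hy : y ∈ (extChartAt 𝓘(ℝ, E) x₀).source ∩ extChartAt 𝓘(ℝ, E) x₀ ⁻¹' U) (hyP : y ∈ P) :
    constantExtension ψ u y ∈ tangentSpaceOf 𝓘(ℝ, E) P y := by
  rw [hS.mem_tangent_iff y hy.1 hy.2 hyP, chartDeriv_constantExtension u hy.1,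
    (hS.isInvertible _ hy.2).self_apply_inverse]
  exact (hS.mem_tangent_iff x₀ (mem_extChartAt_source x₀) hS.mem_base hx u).1 hu

theorem isSmoothFieldOn_constantExtension (hS : IsSlice P x₀ ψ U L)
    (u : TangentSpace 𝓘(ℝ, E) x₀) :
    IsSmoothFieldOn 𝓘(ℝ, E) (constantExtension ψ u)
      ((extChartAt 𝓘(ℝ, E) x₀).source ∩ extChartAt 𝓘(ℝ, E) x₀ ⁻¹' U) := by
  have := FiniteDimensional.complete ℝ E
  intro y hy
  refine ContMDiffAt.contMDiffWithinAt ((contMDiffAt_field_iff hy.1 _).2 ?_)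
  have h1 : ContDiffAt ℝ ∞ (fun q => (fderiv ℝ ψ q).inverse
      (fderiv ℝ ψ (extChartAt 𝓘(ℝ, E) x₀ x₀) (chartDeriv 𝓘(ℝ, E) x₀ x₀ u)))
      (extChartAt 𝓘(ℝ, E) x₀ y) :=
    (((hS.isInvertible _ hy.2).contDiffAt_map_inverse.comp (extChartAt 𝓘(ℝ, E) x₀ y)
      ((hS.contDiffOn.contDiffAt (hS.isOpen.mem_nhds hy.2)).fderiv_right (by simp)))).clm_apply
      contDiffAt_const
  refine h1.congr_of_eventuallyEq ?_
  filter_upwards [extChartAt_target_mem_nhds' ((extChartAt 𝓘(ℝ, E) x₀).map_source hy.1)] with q hq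
  rw [fieldRep, chartDeriv_constantExtension u ((extChartAt 𝓘(ℝ, E) x₀).map_target hq),
    (extChartAt 𝓘(ℝ, E) x₀).right_inv hq]

end IsSlice

namespace FinslerMetric

variable [FiniteDimensional ℝ E] (F : FinslerMetric E M)

/-- The bilinear form on `T_x P` read off from the slice map `ψ`. -/
def sliceForm (P : Set M) (ψ : E → E) (η : TM E M) :
    LinearMap.BilinForm ℝ (tangentSpaceOf 𝓘(ℝ, E) P η.proj) :=
  (tangentBilin (F.energyRep η) ψ (extChartAt 𝓘(ℝ, E).tangent η η)).compl₁₂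
    ((chartDeriv 𝓘(ℝ, E) η.proj η.proj : TangentSpace 𝓘(ℝ, E) η.proj →ₗ[ℝ] E) ∘ₗ
      Submodule.subtype _)
    ((chartDeriv 𝓘(ℝ, E) η.proj η.proj : TangentSpace 𝓘(ℝ, E) η.proj →ₗ[ℝ] E) ∘ₗ
      Submodule.subtype _)

omit [FiniteDimensional ℝ E] in
theorem sliceForm_apply (P : Set M) (ψ : E → E) (η : TM E M)
    (u v : tangentSpaceOf 𝓘(ℝ, E) P η.proj) :
    F.sliceForm P ψ η u v = tangentBilin (F.energyRep η) ψ (extChartAt 𝓘(ℝ, E).tangent η η)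
      (chartDeriv 𝓘(ℝ, E) η.proj η.proj (u : TangentSpace 𝓘(ℝ, E) η.proj))
      (chartDeriv 𝓘(ℝ, E) η.proj η.proj (v : TangentSpace 𝓘(ℝ, E) η.proj)) := rfl

variable {P : Set M} {η : TM E M} (hη : η ∈ F.normalBundle P) {ψ : E → E} {U : Set E}
  {L : Submodule ℝ E} (hS : IsSlice P η.proj ψ U L)

include hη hS

theorem isSymm_sliceForm : (F.sliceForm P ψ η).IsSymm := by
  have hs := mem_extChartAt_source (I := 𝓘(ℝ, E)) η.proj
  have hpU : (extChartAt 𝓘(ℝ, E).tangent η η).1 ∈ U := by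
    rw [tangent_extChartAt_apply hs]; exact hS.mem_base
  refine ⟨fun u v => ?_⟩
  rw [sliceForm_apply, sliceForm_apply, (F.isEnergyOn η).tangentBilin_symm hS.isOpen hS.contDiffOn
    ((mem_slitRange_iff hs).2 hη.2.1) hpU]

theorem isTangentForm_sliceForm : F.IsTangentForm P η (F.sliceForm P ψ η) := by
  have hs := mem_extChartAt_source (I := 𝓘(ℝ, E)) η.proj
  have hfst : (extChartAt 𝓘(ℝ, E).tangent η η).1 = extChartAt 𝓘(ℝ, E) η.proj η.proj := by
    rw [tangent_extChartAt_apply hs]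
  have hT : ∀ v : TangentSpace 𝓘(ℝ, E) η.proj, v ∈ tangentSpaceOf 𝓘(ℝ, E) P η.proj ↔
      chartDeriv 𝓘(ℝ, E) η.proj η.proj v ∈
        L.comap (fderiv ℝ ψ (extChartAt 𝓘(ℝ, E).tangent η η).1 : E →ₗ[ℝ] E) := by
    intro v
    rw [hS.mem_tangent_iff _ hs hS.mem_base hη.1, ← hfst]
    rfl
  intro X
  rw [F.mem_tangentSpaceOf_normalBundle_iff hη hS, ← chartDeriv_dpi hs X, ← hT]
  have key : ∀ u : TangentSpace 𝓘(ℝ, E) η.proj,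
      F.g η (vliftInv η (verticalProj F.spray η X)) u =
        fderiv ℝ (fderiv ℝ (F.energyRep η)) (extChartAt 𝓘(ℝ, E).tangent η η)
          (0, (chartDeriv 𝓘(ℝ, E).tangent η η X).2 +
            nonlinConn (F.energyRep η) (extChartAt 𝓘(ℝ, E).tangent η η)
              (chartDeriv 𝓘(ℝ, E) η.proj η.proj (dpi η X)))
          (0, chartDeriv 𝓘(ℝ, E) η.proj η.proj u) := by
    intro u
    rw [F.g_eq hs hη.2.1, F.chartDeriv_vliftInv_verticalProj hη.2.1, chartDeriv_dpi hs X]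
  constructor
  · rintro ⟨hX, h⟩
    refine ⟨hX, fun u => ?_⟩
    rw [key, sliceForm_apply]
    exact h _ ((hT _).1 u.2)
  · rintro ⟨hX, h⟩
    refine ⟨hX, fun u hu => ?_⟩
    obtain ⟨u, rfl⟩ := chartDeriv_surjective hs u
    rw [← key u]
    exact h ⟨u, (hT u).2 hu⟩

/-- The tangent space of ν(P) projects onto T_xP, so it determines the values of a tangent form on
all of T_xP; uniqueness rests on this. -/
theorem exists_dpi_eq_of_isTangentForm (u : tangentSpaceOf 𝓘(ℝ, E) P η.proj) :
    ∃ X ∈ tangentSpaceOf 𝓘(ℝ, E).tangent (F.normalBundle P) η, dpi η X = u := by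
  have hs := mem_extChartAt_source (I := 𝓘(ℝ, E)) η.proj
  have hs' := mem_extChartAt_source (I := 𝓘(ℝ, E).tangent) η
  have hfst : (extChartAt 𝓘(ℝ, E).tangent η η).1 = extChartAt 𝓘(ℝ, E) η.proj η.proj := by
    rw [tangent_extChartAt_apply hs]
  obtain ⟨b, hb⟩ := (F.isEnergyOn η).exists_tangent_vector ψ
    ((mem_slitRange_iff hs).2 hη.2.1) (chartDeriv 𝓘(ℝ, E) η.proj η.proj
      (u : TangentSpace 𝓘(ℝ, E) η.proj))
  obtain ⟨X, hX⟩ := chartDeriv_surjective hs' ((chartDeriv 𝓘(ℝ, E) η.proj η.proj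
      (u : TangentSpace 𝓘(ℝ, E) η.proj), b) : E × E)
  refine ⟨X, ?_, ?_⟩
  · rw [F.mem_tangentSpaceOf_normalBundle_iff hη hS, hX]
    refine ⟨?_, fun v _ => hb v⟩
    rw [hfst]
    exact (hS.mem_tangent_iff _ hs hS.mem_base hη.1 _).1 u.2
  · apply chartDeriv_injective hs
    rw [chartDeriv_dpi hs, hX]

theorem IsTangentForm.unique {b b' : LinearMap.BilinForm ℝ (tangentSpaceOf 𝓘(ℝ, E) P η.proj)}
    (hb : F.IsTangentForm P η b) (hb' : F.IsTangentForm P η b') : b' = b := by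
  ext u v
  obtain ⟨X, hX, hXu⟩ := F.exists_dpi_eq_of_isTangentForm hη hS u
  obtain ⟨h1, h2⟩ := (hb X).1 hX
  obtain ⟨h3, h4⟩ := (hb' X).1 hX
  have hu : (⟨dpi η X, h1⟩ : tangentSpaceOf 𝓘(ℝ, E) P η.proj) = u := Subtype.ext hXu
  have h5 := h2 v
  have h6 := h4 v
  rw [hu] at h5 h6
  linarith

/-- Each of the two terms of the definition equals B(u, v), by `g_self_affine_of_tangent` and
symmetry, for every admissible pair of extensions; this is well-definedness. Conversely, the
defining property pins down h only if tangent extensions exist, which `constantExtension` supplies.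
-/
theorem isSecondFundamentalForm_iff {N : VerticalConnection E M} (hN : N.IsLift F.spray)
    (hM : F.M1 N)
    (h : tangentSpaceOf 𝓘(ℝ, E) P η.proj → tangentSpaceOf 𝓘(ℝ, E) P η.proj → ℝ) :
    F.IsSecondFundamentalForm N P η h ↔ h = fun u v => F.sliceForm P ψ η u v := by
  have hs := mem_extChartAt_source (I := 𝓘(ℝ, E)) η.proj
  have hadd : ∀ a b : TangentSpace 𝓘(ℝ, E) η.proj,
      F.g η η.2 (a + b) = F.g η η.2 a + F.g η η.2 b := by
    intro a b
    have h0 : ((0, chartDeriv 𝓘(ℝ, E) η.proj η.proj a + chartDeriv 𝓘(ℝ, E) η.proj η.proj b) :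
        E × E) = (0, chartDeriv 𝓘(ℝ, E) η.proj η.proj a) +
          (0, chartDeriv 𝓘(ℝ, E) η.proj η.proj b) := by simp
    rw [F.g_self_left_eq hs hη.2.1, F.g_self_left_eq hs hη.2.1, F.g_self_left_eq hs hη.2.1,
      map_add, h0, map_add]
  have key : ∀ u v : tangentSpaceOf 𝓘(ℝ, E) P η.proj, ∀ O : Set M, IsOpen O → η.proj ∈ O →
      ∀ U V : Π x : M, TangentSpace 𝓘(ℝ, E) x,
      IsSmoothFieldOn 𝓘(ℝ, E) U O → IsSmoothFieldOn 𝓘(ℝ, E) V O →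
      (∀ y ∈ O ∩ P, U y ∈ tangentSpaceOf 𝓘(ℝ, E) P y) →
      (∀ y ∈ O ∩ P, V y ∈ tangentSpaceOf 𝓘(ℝ, E) P y) →
      U η.proj = u → V η.proj = v →
      (1 / 2) * F.g η η.2 (N.affine F.spray η (U η.proj) V + N.affine F.spray η (V η.proj) U) =
        F.sliceForm P ψ η u v := by
    intro u v O hO hηO U V hU hV hUP hVP hUu hVv
    rw [hadd, F.g_self_affine_of_tangent hN hM hη hS (hUP _ ⟨hηO, hη.1⟩) hO hηO hV hVP,
      F.g_self_affine_of_tangent hN hM hη hS (hVP _ ⟨hηO, hη.1⟩) hO hηO hU hUP, hUu, hVv,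
      ← sliceForm_apply, ← sliceForm_apply, ← (F.isSymm_sliceForm hη hS).eq u v]
    ring
  constructor
  · intro hh
    funext u v
    have hO := hS.isOpen_source_inter
    have hηO : η.proj ∈ (extChartAt 𝓘(ℝ, E) η.proj).source ∩
      extChartAt 𝓘(ℝ, E) η.proj ⁻¹' U := ⟨hs, hS.mem_base⟩
    have hU := hS.isSmoothFieldOn_constantExtension (u : TangentSpace 𝓘(ℝ, E) η.proj)
    have hV := hS.isSmoothFieldOn_constantExtension (v : TangentSpace 𝓘(ℝ, E) η.proj)
    have hUP := fun y (hy : y ∈ _ ∩ P) => hS.constantExtension_mem hη.1 u.2 hy.1 hy.2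
    have hVP := fun y (hy : y ∈ _ ∩ P) => hS.constantExtension_mem hη.1 v.2 hy.1 hy.2
    have hu := hS.constantExtension_self (u : TangentSpace 𝓘(ℝ, E) η.proj)
    have hv := hS.constantExtension_self (v : TangentSpace 𝓘(ℝ, E) η.proj)
    rw [hh u v _ hO hηO _ _ hU hV hUP hVP hu hv]
    exact key u v _ hO hηO _ _ hU hV hUP hVP hu hv
  · rintro rfl
    intro u v O hO hηO U V hU hV hUP hVP hUu hVv
    exact (key u v O hO hηO U V hU hV hUP hVP hUu hVv).symm

end FinslerMetric

end SecondFundamentalForm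

end FinslerSFF

end

theorem mainTheorem7 {E : Type*} [NormedAddCommGroup E] [NormedSpace ℝ E] [FiniteDimensional ℝ E]
    {M : Type*} [TopologicalSpace M] [T2Space M] [SecondCountableTopology M]
    [ChartedSpace E M] [IsManifold 𝓘(ℝ, E) ∞ M]
    (F : FinslerSFF.FinslerMetric E M) (P : Set M)
    (hP : FinslerSFF.IsEmbeddedSubmanifold 𝓘(ℝ, E) P) :
    FinslerSFF.IsLagrangianSubmanifold 𝓘(ℝ, E).tangent F.omega (F.normalBundle P) ∧
    ∀ η ∈ F.normalBundle P,
      ∃ b : LinearMap.BilinForm ℝ (FinslerSFF.tangentSpaceOf 𝓘(ℝ, E) P η.proj),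
        (b.IsSymm ∧ F.IsTangentForm P η b) ∧
        (∀ b' : LinearMap.BilinForm ℝ (FinslerSFF.tangentSpaceOf 𝓘(ℝ, E) P η.proj),
          b'.IsSymm → F.IsTangentForm P η b' → b' = b) ∧
        ∀ N : FinslerSFF.VerticalConnection E M, N.IsLift F.spray → F.M1 N → F.M2 N →
          ∀ h, F.IsSecondFundamentalForm N P η h ↔ h = fun u v => b u v := by
  refine ⟨F.isLagrangianSubmanifold_normalBundle hP, fun η hη => ?_⟩
  obtain ⟨ψ, U, L, hS⟩ := FinslerSFF.exists_isSlice hP hη.1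
  have hT := F.isTangentForm_sliceForm hη hS
  -- The form is built from one chosen slice map ψ; the uniqueness clause shows that it does not
  -- depend on that choice.
  exact ⟨F.sliceForm P ψ η, ⟨F.isSymm_sliceForm hη hS, hT⟩,
    fun b' _ hb' => FinslerSFF.FinslerMetric.IsTangentForm.unique F hη hS hT hb',
    fun N hN hM _ h => F.isSecondFundamentalForm_iff hη hS hN hM h⟩
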